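/- Let $X$ be a compact smooth manifold (Hausdorff, without boundary) of real dimension $4$ with a smooth almost-complex structure $J$, and let $g$ be a smooth Hermitian metric on $(X,J)$, that is, a Riemannian metric with $g(J\cdot,J\cdot)=g$, with fundamental form $\omega(u,v)=g(Ju,v)$. Orient $X$ by $\omega^2/2$ and let $*$ be the ($\mathbb{C}$-linear) Hodge star operator. For a complex form $\alpha$ of bidegree $(p,q)$ let $\partial\alpha$ and $\overline\partial\alpha$ be the components of $d\alpha$ of bidegree $(p+1,q)$ and $(p,q+1)$. Put $d^*=-*d*$, $\overline\partial^*=-*\partial*$ (the formal adjoints of $d$ and $\overline\partial$), $\Delta_d=dd^*+d^*d$ and $\Delta_{\overline\partial}=\overline\partial\,\overline\partial^*+\overline\partial^*\overline\partial$. Let $\mathcal{H}^{1,1}_{\overline\partial}$ be the space of smooth complex $(1,1)$-forms $\psi$ with $\Delta_{\overline\partial}\psi=0$ and $h^{1,1}_{\overline\partial}$ its complex dimension. Let $\mathcal{H}^-_g$ be the space of smooth complex $(1,1)$-forms $\gamma$ with $*\gamma=-\gamma$ and $\Delta_d\gamma=0$, and let $b_-$ be the real dimension of the space of smooth real $2$-forms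 $\gamma$ with $*\gamma=-\gamma$ and $\Delta_d\gamma=0$. Then $$\mathcal{H}^-_g\subseteq\mathcal{H}^{1,1}_{\overline\partial},\qquad\text{and}\qquad h^{1,1}_{\overline\partial}\ \geq\ b_-.$$ -/

import Mathlib

open scoped Manifold ContDiff Bundle

noncomputable section

namespace AlmostHermitian

/-! ### Pointwise linear algebra

`V` is a real topological vector space; in the applications it is a tangent space of a
four-dimensional manifold. -/

section Pointwise

variable {V : Type*} [AddCommGroup V] [Module ℝ V] [TopologicalSpace V]
variable {F : Type*} [NormedAddCommGroup F] [NormedSpace ℝ F]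

/-- Inserting vectors `w` into the first `k` slots of an alternating form of degree `n = k + l`. -/
def contract {k l n : ℕ} (h : k + l = n) (w : Fin k → V) (β : V [⋀^Fin n]→L[ℝ] F) :
    V [⋀^Fin l]→L[ℝ] F :=
  have key : ∀ (v : Fin l → V) (i : Fin l) (x : V) [DecidableEq (Fin l)],
      (fun a => Fin.append w (Function.update v i x) (Fin.cast h.symm a)) =
        Function.update (fun a => Fin.append w v (Fin.cast h.symm a))
          (Fin.cast h (Fin.natAdd k i)) x := by
    subst h
    intro v i x _
    funext a
    induction a using Fin.addCases with
    | left a =>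
      rw [Function.update_of_ne]
      · simp
      · intro hh
        have := congrArg Fin.val hh
        simp at this
        omega
    | right a =>
      by_cases ha : a = i
      · subst ha
        simp
      · rw [Function.update_of_ne]
        · simp [ha]
        · intro hh
          apply ha
          have := congrArg Fin.val hh
          simp at this
          omega
  { toFun := fun v => β (fun a => Fin.append w v (Fin.cast h.symm a))
    map_update_add' := by
      intro _ v i x y
      rw [key, key, key, β.map_update_add]
    map_update_smul' := by
      intro _ v i c x
      rw [key, key, β.map_update_smul]
    map_eq_zero_of_eq' := by
      intro v i j hv hij
      refine β.map_eq_zero_of_eq _ (i := Fin.cast h (Fin.natAdd k i))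
        (j := Fin.cast h (Fin.natAdd k j)) ?_ ?_
      · simpa using hv
      · intro hh
        apply hij
        have := congrArg Fin.val hh
        simp at this
        omega
    cont := by
      refine β.cont.comp (continuous_pi fun a => ?_)
      subst h
      induction a using Fin.addCases with
      | left a => simpa using continuous_const
      | right a => simpa using continuous_apply a }

/-- The top form `η ∧ η / 2` of a `2`-form `η` (the Riemannian volume form of a Hermitian vector
space of complex dimension two with fundamental form `η`). -/
def halfSquare (η : V [⋀^Fin 2]→L[ℝ] ℝ) : V [⋀^Fin 4]→L[ℝ] ℝ :=
  have hu0 : ∀ a b c : V, Function.update ![a, b] 0 c = ![c, b] := fun a b c => by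
    funext i; fin_cases i <;> rfl
  have hu1 : ∀ a b c : V, Function.update ![a, b] 1 c = ![a, c] := fun a b c => by
    funext i; fin_cases i <;> rfl
  have hadd : ∀ x y z : V, η ![x + y, z] = η ![x, z] + η ![y, z] := fun x y z => by
    have h := η.map_update_add ![x, z] 0 x y
    rwa [hu0, hu0, hu0] at h
  have hsmul : ∀ (c : ℝ) (x z : V), η ![c • x, z] = c * η ![x, z] := fun c x z => by
    have h := η.map_update_smul ![x, z] 0 c x
    rwa [hu0, hu0] at h
  have hself : ∀ x : V, η ![x, x] = 0 := fun x =>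
    η.map_eq_zero_of_eq ![x, x] (i := 0) (j := 1) rfl (by decide)
  have hswap : ∀ x y : V, η ![x, y] = - η ![y, x] := fun x y => by
    have h2 : η ![x, x + y] = η ![x, x] + η ![x, y] := by
      have h := η.map_update_add ![x, y] 1 x y
      rwa [hu1, hu1, hu1] at h
    have h3 : η ![y, x + y] = η ![y, x] + η ![y, y] := by
      have h := η.map_update_add ![y, y] 1 x y
      rwa [hu1, hu1, hu1] at h
    have h1 := hself (x + y)
    rw [hadd, h2, h3, hself, hself] at h1
    linarith
  have hadd' : ∀ x y z : V, η ![z, x + y] = η ![z, x] + η ![z, y] := fun x y z => by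
    rw [hswap, hadd, hswap x, hswap y]; ring
  have hsmul' : ∀ (c : ℝ) (x z : V), η ![z, c • x] = c * η ![z, x] := fun c x z => by
    rw [hswap, hsmul, hswap x]; ring
  { toFun := fun v => η ![v 0, v 1] * η ![v 2, v 3] - η ![v 0, v 2] * η ![v 1, v 3] +
      η ![v 0, v 3] * η ![v 1, v 2]
    map_update_add' := by
      intro inst v i x y
      obtain rfl : inst = instDecidableEqFin 4 := Subsingleton.elim _ _
      fin_cases i <;> simp [Function.update, hadd, hadd'] <;> ring
    map_update_smul' := by
      intro inst v i c x
      obtain rfl : inst = instDecidableEqFin 4 := Subsingleton.elim _ _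
      fin_cases i <;> simp [Function.update, hsmul, hsmul'] <;> ring
    map_eq_zero_of_eq' := by
      intro v i j hv hij
      change η ![v 0, v 1] * η ![v 2, v 3] - η ![v 0, v 2] * η ![v 1, v 3] +
        η ![v 0, v 3] * η ![v 1, v 2] = 0
      have main : ∀ a b : Fin 4, a < b → v a = v b →
          η ![v 0, v 1] * η ![v 2, v 3] - η ![v 0, v 2] * η ![v 1, v 3] +
            η ![v 0, v 3] * η ![v 1, v 2] = 0 := by
        intro a b hab h
        fin_cases a <;> fin_cases b <;> simp at hab h <;> rw [h]
        · rw [hself]; ring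
        · rw [hself, hswap (v 1) (v 2)]; ring
        · rw [hself, hswap (v 3) (v 1), hswap (v 3) (v 2)]; ring
        · rw [hself]; ring
        · rw [hself, hswap (v 3) (v 2)]; ring
        · rw [hself]; ring
      rcases lt_or_gt_of_ne hij with hlt | hlt
      · exact main i j hlt hv
      · exact main j i hlt hv.symm
    cont := by
      have hc : ∀ i j : Fin 4, Continuous fun v : Fin 4 → V => η ![v i, v j] := fun i j => by
        refine η.cont.comp (continuous_pi fun a => ?_)
        fin_cases a
        · exact continuous_apply i
        · exact continuous_apply j
      exact (((hc 0 1).mul (hc 2 3)).sub ((hc 0 2).mul (hc 1 3))).add ((hc 0 3).mul (hc 1 2)) }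

/-- The basis `b^i = ∑ⱼ g^{ij} bⱼ` that is dual to the basis `b` with respect to the inner
product `g`, where `(g^{ij})` is the inverse of the Gram matrix `(g(bᵢ, bⱼ))`. -/
def metricDual {n : ℕ} (g : V →L[ℝ] V →L[ℝ] ℝ) (b : Fin n → V) (i : Fin n) : V :=
  ∑ j, (Matrix.of fun a c => g (b a) (b c))⁻¹ i j • b j

/-- The Hodge star operator from `k`-forms to `l`-forms, `k + l = 4`, of the inner product `g` with
volume form `vol`, computed in the basis `b`:
`(*α)(v₁, …, v_l) = 1/k! ∑_{i₁, …, i_k} α(b^{i₁}, …, b^{i_k}) vol(b_{i₁}, …, b_{i_k}, v₁, …, v_l)`.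
The result does not depend on the basis. On complex-valued forms it is the complex-linear
extension of the star operator on real-valued forms. -/
def starAt {k l : ℕ} (h : k + l = 4) (g : V →L[ℝ] V →L[ℝ] ℝ) (vol : V [⋀^Fin 4]→L[ℝ] ℝ)
    (b : Fin 4 → V) (α : V [⋀^Fin k]→L[ℝ] F) : V [⋀^Fin l]→L[ℝ] F :=
  ((k.factorial : ℝ)⁻¹) • ∑ i : Fin k → Fin 4,
    (ContinuousLinearMap.toSpanSingleton ℝ
      (α fun a => metricDual g b (i a))).compContinuousAlternatingMap
        (contract h (fun a => b (i a)) vol)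

/-- The value of the complex-multilinear extension of `α` on the vectors
`vᵢ^{1,0} = (vᵢ - √-1 J vᵢ) / 2` in the slots `i ∈ S` and
`vᵢ^{0,1} = (vᵢ + √-1 J vᵢ) / 2` in the slots `i ∉ S`, expanded by multilinearity: `T` is the set of
slots in which the term with `J vᵢ` is taken. -/
def slotPart {k : ℕ} (J : V →L[ℝ] V) (S : Finset (Fin k)) (α : V [⋀^Fin k]→L[ℝ] ℂ) :
    ContinuousMultilinearMap ℝ (fun _ : Fin k => V) ℂ :=
  ((1 / 2 : ℂ) ^ k) • ∑ T : Finset (Fin k),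
    (∏ i ∈ T, if i ∈ S then -Complex.I else Complex.I) •
      α.toContinuousMultilinearMap.compContinuousLinearMap
        (fun i => if i ∈ T then J else ContinuousLinearMap.id ℝ V)

lemma slotPart_swap {k : ℕ} (J : V →L[ℝ] V) (S : Finset (Fin k)) (α : V [⋀^Fin k]→L[ℝ] ℂ)
    (v : Fin k → V) (i j : Fin k) (hij : i ≠ j) (hv : v i = v j) :
    slotPart J (S.map (Equiv.swap i j).toEmbedding) α v = - slotPart J S α v := by
  have hmem : ∀ (U : Finset (Fin k)) (a : Fin k),
      Equiv.swap i j a ∈ U.map (Equiv.swap i j).toEmbedding ↔ a ∈ U := by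
    intro U a
    simp
  have hvs : ∀ a, v (Equiv.swap i j a) = v a := by
    intro a
    rcases Equiv.swap_apply_eq_iff.mp (rfl : Equiv.swap i j a = _) with _
    by_cases h1 : a = i
    · subst h1; simp [hv]
    · by_cases h2 : a = j
      · subst h2; simp [hv]
      · rw [Equiv.swap_apply_of_ne_of_ne h1 h2]
  simp only [slotPart, smul_apply, sum_apply,
    ContinuousMultilinearMap.compContinuousLinearMap_apply, ← smul_neg, ← Finset.sum_neg_distrib]
  congr 1
  rw [← (Equiv.finsetCongr (Equiv.swap i j)).sum_comp]
  refine Finset.sum_congr rfl fun T _ => ?_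
  congr 1
  · simp [Equiv.finsetCongr_apply, Finset.prod_map]
  · have := α.toAlternatingMap.map_swap
      (fun a => (if a ∈ T then J else ContinuousLinearMap.id ℝ V) (v a)) hij
    refine Eq.trans ?_ this
    refine congrArg α (funext fun a => ?_)
    have h1 : a ∈ (Equiv.finsetCongr (Equiv.swap i j)) T ↔ Equiv.swap i j a ∈ T := by
      rw [Equiv.finsetCongr_apply, ← hmem T (Equiv.swap i j a), Equiv.swap_apply_self]
    simp only [h1, Function.comp_apply, hvs]

/-- The component of bidegree `(p, q)` of a complex-valued form `α`, with respect to the complex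
structure `J`: the sum, over all ways of choosing `p` slots of type `(1,0)` and `q` slots of type
`(0,1)`, of the values of (the complex-multilinear extension of) `α` on the corresponding
components of the arguments. It is zero unless `p + q` is the degree of `α`. -/
def bidegreePart {k : ℕ} (J : V →L[ℝ] V) (p q : ℕ) (α : V [⋀^Fin k]→L[ℝ] ℂ) :
    V [⋀^Fin k]→L[ℝ] ℂ :=
  { (∑ S : Finset (Fin k) with S.card = p ∧ Sᶜ.card = q, slotPart J S α :
      ContinuousMultilinearMap ℝ (fun _ : Fin k => V) ℂ) with
    map_eq_zero_of_eq' := by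
      intro v i j hv hij
      change (∑ S : Finset (Fin k) with S.card = p ∧ Sᶜ.card = q, slotPart J S α) v = 0
      rw [sum_apply, Finset.sum_filter]
      set f : Finset (Fin k) → ℂ := fun S =>
        if S.card = p ∧ Sᶜ.card = q then slotPart J S α v else 0 with hf
      have h1 : ∀ S, f (Equiv.finsetCongr (Equiv.swap i j) S) = - f S := by
        intro S
        simp only [hf, Equiv.finsetCongr_apply, Finset.card_compl, Finset.card_map,
          slotPart_swap J S α v i j hij hv]
        split_ifs <;> simp
      have h2 : ∑ S, f S = - ∑ S, f S := by
        conv_lhs => rw [← (Equiv.finsetCongr (Equiv.swap i j)).sum_comp]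
        simp only [h1, Finset.sum_neg_distrib]
      exact self_eq_neg.mp h2 }

end Pointwise

/-! ### Almost-Hermitian four-manifolds and their differential forms -/

/-- The model space `ℝ⁴`. -/
abbrev E4 : Type := EuclideanSpace ℝ (Fin 4)

section Manifold

variable (X : Type*) [TopologicalSpace X] [ChartedSpace E4 X]

/-- A smooth almost-complex structure: a smooth field `J` of endomorphisms of the tangent spaces
with `J² = -1`. -/
structure AlmostComplexStructure [IsManifold (𝓡 4) ∞ X] where
  toFun : ∀ x : X, TangentSpace (𝓡 4) x →L[ℝ] TangentSpace (𝓡 4) x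
  sq : ∀ (x : X) (v : TangentSpace (𝓡 4) x), toFun x (toFun x v) = -v
  contMDiff : ContMDiff (𝓡 4) ((𝓡 4).prod 𝓘(ℝ, E4 →L[ℝ] E4)) ∞
    (fun x => Bundle.TotalSpace.mk' (E4 →L[ℝ] E4)
      (E := fun x : X => TangentSpace (𝓡 4) x →L[ℝ] TangentSpace (𝓡 4) x) x (toFun x))

variable {X} [IsManifold (𝓡 4) ∞ X]

/-- A smooth Hermitian metric on the almost-complex manifold `(X, J)`: a smooth Riemannian metric
for which every `J x` is an isometry. -/
structure HermitianMetric (J : AlmostComplexStructure X) extends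
    Bundle.ContMDiffRiemannianMetric (𝓡 4) ∞ E4 (fun x : X => TangentSpace (𝓡 4) x) where
  inner_J : ∀ (x : X) (u v : TangentSpace (𝓡 4) x),
    inner x (J.toFun x u) (J.toFun x v) = inner x u v

variable (X) in
/-- Fields of alternating `k`-forms on `X` with values in `F` (no regularity is required here). -/
abbrev Form (k : ℕ) (F : Type*) [NormedAddCommGroup F] [NormedSpace ℝ F] : Type _ :=
  ∀ x : X, TangentSpace (𝓡 4) x [⋀^Fin k]→L[ℝ] F

variable {F : Type*} [NormedAddCommGroup F] [NormedSpace ℝ F] {k : ℕ}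

/-- The expression of a form in the preferred chart at `x₀`: its pullback to the model space along
the inverse of the chart. -/
def inChart (α : Form X k F) (x₀ : X) (y : E4) : E4 [⋀^Fin k]→L[ℝ] F :=
  (α ((extChartAt (𝓡 4) x₀).symm y)).compContinuousLinearMap
    (mfderiv 𝓘(ℝ, E4) (𝓡 4) (extChartAt (𝓡 4) x₀).symm y)

/-- A form is smooth if it is smooth in charts. -/
def IsSmooth (α : Form X k F) : Prop :=
  ∀ x₀ : X, ContDiffOn ℝ ∞ (inChart α x₀) (extChartAt (𝓡 4) x₀).target

/-- The exterior derivative, computed at `x` in the preferred chart at `x`. -/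
def extD (α : Form X k F) : Form X (k + 1) F := fun x =>
  (extDeriv (inChart α x) (extChartAt (𝓡 4) x x)).compContinuousLinearMap
    (mfderiv (𝓡 4) 𝓘(ℝ, E4) (extChartAt (𝓡 4) x) x)

/-- The component of bidegree `(p, q)` of a complex-valued form. -/
def part (J : AlmostComplexStructure X) (p q : ℕ) (α : Form X k ℂ) : Form X k ℂ := fun x =>
  bidegreePart (J.toFun x) p q (α x)

/-- A complex-valued form has bidegree `(p, q)` if it equals its component of that bidegree. -/
def HasBidegree (J : AlmostComplexStructure X) (p q : ℕ) (α : Form X k ℂ) : Prop :=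
  part J p q α = α

/-- The operator `∂`, mapping a form of bidegree `(p, q)` to the component of bidegree `(p + 1, q)`
of its exterior derivative. -/
def del (J : AlmostComplexStructure X) (α : Form X k ℂ) : Form X (k + 1) ℂ :=
  ∑ pq ∈ Finset.HasAntidiagonal.antidiagonal k, part J (pq.1 + 1) pq.2 (extD (part J pq.1 pq.2 α))

/-- The operator `∂̄`, mapping a form of bidegree `(p, q)` to the component of bidegree `(p, q + 1)`
of its exterior derivative. -/
def delbar (J : AlmostComplexStructure X) (α : Form X k ℂ) : Form X (k + 1) ℂ :=
  ∑ pq ∈ Finset.HasAntidiagonal.antidiagonal k, part J pq.1 (pq.2 + 1) (extD (part J pq.1 pq.2 α))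

namespace HermitianMetric

variable {J : AlmostComplexStructure X} (g : HermitianMetric J)

/-- The fundamental form `ω(u, v) = g(J u, v)`. -/
def fundamentalForm : Form X 2 ℝ := fun x =>
  have hself : ∀ u : TangentSpace (𝓡 4) x, g.inner x (J.toFun x u) u = 0 := fun u => by
    have h := g.inner_J x (J.toFun x u) u
    rw [J.sq, g.symm x (J.toFun x u) u, map_neg, neg_apply] at h
    have h' := g.symm x (J.toFun x u) u
    linarith
  { toFun := fun v => g.inner x (J.toFun x (v 0)) (v 1)
    map_update_add' := by
      intro inst v i a b
      obtain rfl : inst = instDecidableEqFin 2 := Subsingleton.elim _ _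
      fin_cases i <;> simp [Function.update]
    map_update_smul' := by
      intro inst v i c a
      obtain rfl : inst = instDecidableEqFin 2 := Subsingleton.elim _ _
      fin_cases i <;> simp [Function.update]
    map_eq_zero_of_eq' := by
      intro v i j hv hij
      have h01 : v 0 = v 1 := by
        fin_cases i <;> fin_cases j <;> simp_all
      change g.inner x (J.toFun x (v 0)) (v 1) = 0
      rw [← h01]
      exact hself _
    cont := by
      let B : E4 →L[ℝ] E4 →L[ℝ] ℝ := g.inner x
      let K : E4 →L[ℝ] E4 := J.toFun x
      have hB : Continuous fun v : Fin 2 → E4 => B (K (v 0)) (v 1) := by fun_prop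
      exact hB }

/-- The Riemannian volume form `ω ∧ ω / 2`; it is positive for the orientation induced by `J`. -/
def volumeForm : Form X 4 ℝ := fun x => halfSquare (g.fundamentalForm x)

/-- The Hodge star operator of an Hermitian metric on a four-manifold, oriented by `J`. It is
computed in the standard basis of the tangent space `T_x X = ℝ⁴`. -/
def star {k l : ℕ} (h : k + l = 4) (α : Form X k F) : Form X l F := fun x =>
  starAt (V := TangentSpace (𝓡 4) x) h (g.inner x) (g.volumeForm x)
    (fun i => (EuclideanSpace.single i (1 : ℝ) : E4)) (α x)

/-- The codifferential `d^* = -* d *` from `(k + 1)`-forms to `k`-forms, where `(k + 1) + l = 4`. -/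
def codiff {k l : ℕ} (h : (k + 1) + l = 4) (h' : (l + 1) + k = 4) (α : Form X (k + 1) F) :
    Form X k F :=
  -g.star h' (extD (g.star h α))

/-- The operator `∂̄^* = -* ∂ *` from `(k + 1)`-forms to `k`-forms, where `(k + 1) + l = 4`. -/
def delbarStar {k l : ℕ} (h : (k + 1) + l = 4) (h' : (l + 1) + k = 4) (α : Form X (k + 1) ℂ) :
    Form X k ℂ :=
  -g.star h' (del J (g.star h α))

/-- The Hodge-de Rham Laplacian `d d^* + d^* d` on `2`-forms. -/
def laplacian (α : Form X 2 F) : Form X 2 F :=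
  extD (g.codiff (k := 1) (l := 2) rfl rfl α) + g.codiff (k := 2) (l := 1) rfl rfl (extD α)

/-- The `∂̄`-Laplacian `∂̄ ∂̄^* + ∂̄^* ∂̄` on `2`-forms. -/
def delbarLaplacian (α : Form X 2 ℂ) : Form X 2 ℂ :=
  delbar J (g.delbarStar (k := 1) (l := 2) rfl rfl α) +
    g.delbarStar (k := 2) (l := 1) rfl rfl (delbar J α)

/-- Anti-self-dual forms: `*α = -α`. -/
def IsAntiSelfDual (α : Form X 2 F) : Prop :=
  g.star (k := 2) (l := 2) rfl α = -α

/-- The anti-self-dual harmonic forms of bidegree `(1,1)`. -/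
def antiSelfDualHarmonic11 : Set (Form X 2 ℂ) :=
  {α | IsSmooth α ∧ HasBidegree J 1 1 α ∧ g.IsAntiSelfDual α ∧ g.laplacian α = 0}

/-- The `∂̄`-harmonic forms of bidegree `(1,1)`. -/
def delbarHarmonic11 : Set (Form X 2 ℂ) :=
  {α | IsSmooth α ∧ HasBidegree J 1 1 α ∧ g.delbarLaplacian α = 0}

/-- The real-valued anti-self-dual harmonic `2`-forms (of whatever type). -/
def antiSelfDualHarmonicReal : Set (Form X 2 ℝ) :=
  {α | IsSmooth α ∧ g.IsAntiSelfDual α ∧ g.laplacian α = 0}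

/-- The number `h^{1,1}_{∂̄}`: the complex dimension of the space of `∂̄`-harmonic `(1,1)`-forms.
(This set of forms is the kernel of a linear operator on smooth forms, hence equal to its span.) -/
def h11 : Cardinal :=
  Module.rank ℂ (Submodule.span ℂ g.delbarHarmonic11)

/-- The number `b_-`: the real dimension of the space of anti-self-dual harmonic real `2`-forms.
(This set of forms is a linear subspace, hence equal to its span.) -/
def bMinus : Cardinal :=
  Module.rank ℝ (Submodule.span ℝ g.antiSelfDualHarmonicReal)

end HermitianMetric

end Manifold

end AlmostHermitian

end

noncomputable section

namespace AlmostHermitian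

section PointwiseStar

variable {V : Type*} [AddCommGroup V] [Module ℝ V] [TopologicalSpace V]
variable {F : Type*} [NormedAddCommGroup F] [NormedSpace ℝ F]

/-- The frame `e` is orthonormal for the bilinear form `g`. -/
def IsOrthoFrame (g : V →L[ℝ] V →L[ℝ] ℝ) (e : Fin 4 → V) : Prop :=
  ∀ i j, g (e i) (e j) = if i = j then 1 else 0

lemma starAt_apply {k l : ℕ} (h : k + l = 4) (g : V →L[ℝ] V →L[ℝ] ℝ) (vol : V [⋀^Fin 4]→L[ℝ] ℝ)
    (b : Fin 4 → V) (α : V [⋀^Fin k]→L[ℝ] F) (v : Fin l → V) :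
    starAt h g vol b α v = ((k.factorial : ℝ)⁻¹) • ∑ i : Fin k → Fin 4,
      contract h (fun a => b (i a)) vol v • α (fun a => metricDual g b (i a)) := by
  simp [starAt]

lemma contract_apply {k l n : ℕ} (h : k + l = n) (w : Fin k → V) (β : V [⋀^Fin n]→L[ℝ] F)
    (v : Fin l → V) : contract h w β v = β (fun a => Fin.append w v (Fin.cast h.symm a)) := rfl

/-- The contraction of `β` as a multilinear function of the inserted vectors. -/
def contractMultilinear {k l n : ℕ} (h : k + l = n) (β : V [⋀^Fin n]→L[ℝ] F) (v : Fin l → V) :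
    MultilinearMap ℝ (fun _ : Fin k => V) F :=
  ({ toFun := fun f => f v
     map_add' := fun _ _ => rfl
     map_smul' := fun _ _ => rfl } :
    MultilinearMap ℝ (fun _ : Fin l => V) F →ₗ[ℝ] F).compMultilinearMap
    (MultilinearMap.currySum (N := fun _ : Fin k ⊕ Fin l => V)
      ((β.toMultilinearMap).domDomCongr ((finCongr h.symm).trans finSumFinEquiv.symm)))

lemma contractMultilinear_apply {k l n : ℕ} (h : k + l = n) (w : Fin k → V)
    (β : V [⋀^Fin n]→L[ℝ] F) (v : Fin l → V) :
    contractMultilinear h β v w = contract h w β v := by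
  subst h
  rw [contract_apply]
  change β _ = β _
  congr 1
  funext a
  induction a using Fin.addCases <;> simp

lemma IsOrthoFrame.inner_sum {g : V →L[ℝ] V →L[ℝ] ℝ} {e : Fin 4 → V} (he : IsOrthoFrame g e)
    (x y : Fin 4 → ℝ) : g (∑ i, x i • e i) (∑ j, y j • e j) = ∑ i, x i * y i := by
  simp only [map_sum, map_smul, sum_apply, smul_apply, smul_eq_mul, he _ _]
  simp [mul_comm]

lemma gram_eq {g : V →L[ℝ] V →L[ℝ] ℝ} (b e : Module.Basis (Fin 4) ℝ V) (he : IsOrthoFrame g e) :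
    (Matrix.of fun a c => g (b a) (b c)) = (e.toMatrix b).transpose * e.toMatrix b := by
  ext a c
  rw [Matrix.mul_apply, Matrix.of_apply]
  have := he.inner_sum (e.repr (b a)) (e.repr (b c))
  rwa [e.sum_repr, e.sum_repr] at this

lemma gram_left_inv {g : V →L[ℝ] V →L[ℝ] ℝ} (b e : Module.Basis (Fin 4) ℝ V)
    (he : IsOrthoFrame g e) :
    b.toMatrix e * (b.toMatrix e).transpose * (Matrix.of fun a c => g (b a) (b c)) = 1 := by
  rw [gram_eq b e he, Matrix.mul_assoc, ← Matrix.mul_assoc _ (e.toMatrix b).transpose,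
    ← Matrix.transpose_mul, e.toMatrix_mul_toMatrix_flip, Matrix.transpose_one, Matrix.one_mul,
    b.toMatrix_mul_toMatrix_flip]

lemma metricDual_eq {g : V →L[ℝ] V →L[ℝ] ℝ} (b e : Module.Basis (Fin 4) ℝ V)
    (he : IsOrthoFrame g e) (i : Fin 4) :
    metricDual g b i = ∑ a, (b.toMatrix e) i a • e a := by
  have hinv : (Matrix.of fun a c => g (b a) (b c))⁻¹
      = b.toMatrix e * (b.toMatrix e).transpose := Matrix.inv_eq_left_inv (gram_left_inv b e he)
  have hb : ∀ j, b j = ∑ a, e.toMatrix b a j • e a := fun j => (e.sum_toMatrix_smul_self b j).symm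
  unfold metricDual
  rw [hinv]
  calc _ = ∑ j, ∑ a, ((b.toMatrix e * (b.toMatrix e).transpose) i j * e.toMatrix b a j) • e a := by
        refine Finset.sum_congr rfl fun j _ => ?_
        conv_lhs => rw [hb j]
        rw [Finset.smul_sum]
        exact Finset.sum_congr rfl fun a _ => smul_smul _ _ _
    _ = ∑ a, ((b.toMatrix e * (b.toMatrix e).transpose) * (e.toMatrix b).transpose) i a • e a := by
        rw [Finset.sum_comm]
        refine Finset.sum_congr rfl fun a _ => ?_
        rw [← Finset.sum_smul]
        rfl
    _ = _ := by
        rw [Matrix.mul_assoc, ← Matrix.transpose_mul, e.toMatrix_mul_toMatrix_flip,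
          Matrix.transpose_one, Matrix.mul_one]

/-- The Hodge star operator may be computed in any orthonormal frame. -/
lemma starAt_apply_of_orthoFrame {k l : ℕ} (h : k + l = 4) {g : V →L[ℝ] V →L[ℝ] ℝ}
    (vol : V [⋀^Fin 4]→L[ℝ] ℝ) (b e : Module.Basis (Fin 4) ℝ V) (he : IsOrthoFrame g e)
    (α : V [⋀^Fin k]→L[ℝ] F) (v : Fin l → V) :
    starAt h g vol b α v = ((k.factorial : ℝ)⁻¹) • ∑ i : Fin k → Fin 4,
      contract h (fun a => e (i a)) vol v • α (fun a => e (i a)) := by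
  rw [starAt_apply]
  congr 1
  have h1 : ∀ i : Fin k → Fin 4, α (fun a => metricDual g b (i a)) =
      ∑ r : Fin k → Fin 4, (∏ a, b.toMatrix e (i a) (r a)) • α (fun a => e (r a)) := by
    intro i
    have : (fun a => metricDual g b (i a)) =
        fun a => ∑ c, (b.toMatrix e) (i a) c • e c := by
      funext a
      exact metricDual_eq b e he (i a)
    rw [this]
    refine (α.toMultilinearMap.map_sum (fun a c => (b.toMatrix e) (i a) c • e c)).trans ?_
    exact Finset.sum_congr rfl fun r _ => α.toMultilinearMap.map_smul_univ _ _
  have h2 : ∀ r : Fin k → Fin 4, contract h (fun a => e (r a)) vol v =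
      ∑ i : Fin k → Fin 4, (∏ a, b.toMatrix e (i a) (r a)) •
        contract h (fun a => b (i a)) vol v := by
    intro r
    have : (fun a => e (r a)) = fun a => ∑ c, (b.toMatrix e) c (r a) • b c := by
      funext a
      exact (b.sum_toMatrix_smul_self e (r a)).symm
    rw [this, ← contractMultilinear_apply, MultilinearMap.map_sum]
    refine Finset.sum_congr rfl fun i _ => ?_
    rw [← contractMultilinear_apply]
    exact MultilinearMap.map_smul_univ _ _ _
  simp only [h1, h2, Finset.smul_sum, Finset.sum_smul]
  rw [Finset.sum_comm]
  refine Finset.sum_congr rfl fun r _ => Finset.sum_congr rfl fun i _ => ?_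
  rw [smul_smul, smul_eq_mul, mul_comm]

end PointwiseStar

section PointwiseFrame

variable {V : Type*} [AddCommGroup V] [Module ℝ V] [TopologicalSpace V]
variable {F : Type*} [NormedAddCommGroup F] [NormedSpace ℝ F]

/-- A frame `(e, Je, f, Jf)` that is orthonormal for `g`. -/
structure IsAdaptedFrame (g : V →L[ℝ] V →L[ℝ] ℝ) (J : V →L[ℝ] V) (e : Fin 4 → V) : Prop where
  ortho : IsOrthoFrame g e
  one : e 1 = J (e 0)
  three : e 3 = J (e 2)

/-- Compatibility of an inner product with a complex structure. -/
structure IsHermitianPair (g : V →L[ℝ] V →L[ℝ] ℝ) (J : V →L[ℝ] V) : Prop where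
  symm : ∀ u v, g u v = g v u
  pos : ∀ v, v ≠ 0 → 0 < g v v
  sq : ∀ v, J (J v) = -v
  inner_J : ∀ u v, g (J u) (J v) = g u v

lemma IsHermitianPair.inner_J_left {g : V →L[ℝ] V →L[ℝ] ℝ} {J : V →L[ℝ] V}
    (h : IsHermitianPair g J) (u v : V) : g (J u) v = -g u (J v) := by
  have := h.inner_J u (J v)
  rw [h.sq, map_neg] at this
  linarith

lemma IsHermitianPair.inner_J_self {g : V →L[ℝ] V →L[ℝ] ℝ} {J : V →L[ℝ] V}
    (h : IsHermitianPair g J) (u : V) : g (J u) u = 0 := by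
  have h1 := h.inner_J_left u u
  have h2 := h.symm u (J u)
  linarith

lemma IsHermitianPair.exists_unit_smul {g : V →L[ℝ] V →L[ℝ] ℝ} {J : V →L[ℝ] V}
    (h : IsHermitianPair g J) {v : V} (hv : v ≠ 0) : ∃ c : ℝ, g (c • v) (c • v) = 1 := by
  refine ⟨(Real.sqrt (g v v))⁻¹, ?_⟩
  have hp := h.pos v hv
  have hs := Real.mul_self_sqrt hp.le
  have : Real.sqrt (g v v) ≠ 0 := (Real.sqrt_pos.2 hp).ne'
  simp only [map_smul, smul_apply, smul_eq_mul]
  field_simp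
  nlinarith

lemma IsHermitianPair.exists_adaptedFrame {g : V →L[ℝ] V →L[ℝ] ℝ} {J : V →L[ℝ] V}
    (h : IsHermitianPair g J) (hV : Module.finrank ℝ V = 4) :
    ∃ e : Module.Basis (Fin 4) ℝ V, IsAdaptedFrame g J e := by
  have : Nontrivial V := Module.nontrivial_of_finrank_pos (R := ℝ) (by omega)
  obtain ⟨v, hv⟩ := exists_ne (0 : V)
  obtain ⟨c, hc⟩ := h.exists_unit_smul hv
  set a := c • v with ha
  obtain ⟨w, hw⟩ : ∃ w, w ∉ Submodule.span ℝ (Set.range ![a, J a]) := by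
    by_contra! hcon
    have h1 : Submodule.span ℝ (Set.range ![a, J a]) = ⊤ := by
      rw [eq_top_iff]; exact fun x _ => hcon x
    have h2 := finrank_range_le_card (R := ℝ) ![a, J a]
    rw [Set.finrank, h1, finrank_top, hV] at h2
    simp at h2
  set u := w - (g w a) • a - (g w (J a)) • J a with hu
  have hu0 : u ≠ 0 := by
    intro h0
    apply hw
    have : w = (g w a) • a + (g w (J a)) • J a := by
      rw [hu, sub_sub, sub_eq_zero] at h0
      exact h0
    rw [this]
    refine Submodule.add_mem _ (Submodule.smul_mem _ _ (Submodule.subset_span ⟨0, rfl⟩))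
      (Submodule.smul_mem _ _ (Submodule.subset_span ⟨1, rfl⟩))
  obtain ⟨d, hd⟩ := h.exists_unit_smul hu0
  set b := d • u with hb
  have hJa : g (J a) (J a) = 1 := by rw [h.inner_J, hc]
  have hJaa : g (J a) a = 0 := h.inner_J_self a
  have haJa : g a (J a) = 0 := by rw [h.symm, hJaa]
  have hub : g b a = 0 := by
    simp [hb, hu, hc, hJaa]
  have hubJ : g b (J a) = 0 := by
    simp [hb, hu, hJa, haJa]
  have horth : IsOrthoFrame g ![a, J a, b, J b] := by
    have e1 : g (J b) a = 0 := by rw [h.inner_J_left, hubJ, neg_zero]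
    have e2 : g (J b) (J a) = 0 := by rw [h.inner_J, hub]
    have e3 : g (J b) (J b) = 1 := by rw [h.inner_J, hd]
    have e4 : g (J b) b = 0 := h.inner_J_self b
    intro i j
    fin_cases i <;> fin_cases j <;> simp [hc, hJaa, haJa, hJa, hub, hubJ, e1, e2, e3, e4, hd,
      h.symm a b, h.symm a (J b), h.symm (J a) b, h.symm (J a) (J b), h.symm b (J b)]
  have hli : LinearIndependent ℝ ![a, J a, b, J b] := by
    rw [Fintype.linearIndependent_iff]
    intro x hx i
    have := horth.inner_sum x (fun j => if j = i then 1 else 0)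
    rw [hx] at this
    simpa using this.symm
  let e := basisOfLinearIndependentOfCardEqFinrank hli (by simp [hV])
  have he : ⇑e = ![a, J a, b, J b] := coe_basisOfLinearIndependentOfCardEqFinrank _ _
  exact ⟨e, by rw [he]; exact ⟨horth, rfl, rfl⟩⟩

end PointwiseFrame

section Components

variable {V : Type*} [AddCommGroup V] [Module ℝ V] [TopologicalSpace V]
variable {F : Type*} [NormedAddCommGroup F] [NormedSpace ℝ F]

lemma sum_fin_two_arrow {M : Type*} [AddCommMonoid M] {n : ℕ} (f : (Fin 2 → Fin n) → M) :
    ∑ i, f i = ∑ a, ∑ b, f ![a, b] := by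
  rw [← (finTwoArrowEquiv (Fin n)).symm.sum_comp, Fintype.sum_prod_type]
  rfl

lemma sum_fin_three_arrow {M : Type*} [AddCommMonoid M] {n : ℕ} (f : (Fin 3 → Fin n) → M) :
    ∑ i, f i = ∑ a, ∑ b, ∑ c, f ![a, b, c] := by
  rw [← (Fin.consEquiv (fun _ : Fin 3 => Fin n)).sum_comp, Fintype.sum_prod_type]
  refine Finset.sum_congr rfl fun a _ => ?_
  rw [sum_fin_two_arrow]
  rfl

lemma map_vec_two_swap (α : V [⋀^Fin 2]→L[ℝ] F) (u v : V) : α ![u, v] = -α ![v, u] := by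
  have := α.toAlternatingMap.map_swap ![v, u] (i := 0) (j := 1) (by decide)
  rw [← show (α.toAlternatingMap (![v, u] ∘ Equiv.swap 0 1) : F) = α ![u, v] from
    congrArg α (by funext i; fin_cases i <;> rfl), this]
  rfl

lemma map_vec_two_smul_left (α : V [⋀^Fin 2]→L[ℝ] F) (c : ℝ) (u v : V) :
    α ![c • u, v] = c • α ![u, v] :=
  α.vecCons_smul ![v] c u

lemma map_vec_two_neg_left (α : V [⋀^Fin 2]→L[ℝ] F) (u v : V) : α ![-u, v] = -α ![u, v] := by
  rw [← neg_one_smul ℝ u, map_vec_two_smul_left, neg_one_smul]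

lemma map_vec_two_neg_right (α : V [⋀^Fin 2]→L[ℝ] F) (u v : V) : α ![u, -v] = -α ![u, v] := by
  rw [map_vec_two_swap, map_vec_two_neg_left, map_vec_two_swap α v u, neg_neg]

lemma map_vec_three_swap_left (α : V [⋀^Fin 3]→L[ℝ] F) (u v w : V) :
    α ![u, v, w] = -α ![v, u, w] := by
  have := α.toAlternatingMap.map_swap ![v, u, w] (i := 0) (j := 1) (by decide)
  rw [← show (α.toAlternatingMap (![v, u, w] ∘ Equiv.swap 0 1) : F) = α ![u, v, w] from
    congrArg α (by funext i; fin_cases i <;> rfl), this]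
  rfl

lemma map_vec_three_swap_right (α : V [⋀^Fin 3]→L[ℝ] F) (u v w : V) :
    α ![u, v, w] = -α ![u, w, v] := by
  have := α.toAlternatingMap.map_swap ![u, w, v] (i := 1) (j := 2) (by decide)
  rw [← show (α.toAlternatingMap (![u, w, v] ∘ Equiv.swap 1 2) : F) = α ![u, v, w] from
    congrArg α (by funext i; fin_cases i <;> rfl), this]
  rfl

lemma map_vec_three_self_left (α : V [⋀^Fin 3]→L[ℝ] F) (u v : V) : α ![u, u, v] = 0 :=
  α.map_eq_zero_of_eq ![u, u, v] (i := 0) (j := 1) rfl (by decide)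

lemma map_vec_three_self_right (α : V [⋀^Fin 3]→L[ℝ] F) (u v : V) : α ![v, u, u] = 0 :=
  α.map_eq_zero_of_eq ![v, u, u] (i := 1) (j := 2) rfl (by decide)

/-- A three-form on a four-dimensional space vanishes if its four components do. -/
lemma three_form_eq_zero (e : Module.Basis (Fin 4) ℝ V) (τ : V [⋀^Fin 3]→L[ℝ] F)
    (h012 : τ ![e 0, e 1, e 2] = 0) (h013 : τ ![e 0, e 1, e 3] = 0)
    (h023 : τ ![e 0, e 2, e 3] = 0) (h123 : τ ![e 1, e 2, e 3] = 0) : τ = 0 := by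
  apply ContinuousAlternatingMap.toAlternatingMap_injective
  refine Module.Basis.ext_alternating e fun v _ => ?_
  have key : ∀ a b c : Fin 4, a < b → b < c → τ ![e a, e b, e c] = 0 := by
    intro a b c hab hbc
    have : (a = 0 ∧ b = 1 ∧ c = 2) ∨ (a = 0 ∧ b = 1 ∧ c = 3) ∨ (a = 0 ∧ b = 2 ∧ c = 3) ∨
      (a = 1 ∧ b = 2 ∧ c = 3) := by omega
    rcases this with ⟨rfl, rfl, rfl⟩ | ⟨rfl, rfl, rfl⟩ | ⟨rfl, rfl, rfl⟩ | ⟨rfl, rfl, rfl⟩ <;>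
      assumption
  have key1 : ∀ a b c : Fin 4, a < b → τ ![e a, e b, e c] = 0 := by
    intro a b c hab
    rcases lt_trichotomy b c with h | rfl | h
    · exact key a b c hab h
    · exact map_vec_three_self_right _ _ _
    · rw [map_vec_three_swap_right, neg_eq_zero]
      rcases lt_trichotomy a c with h' | rfl | h'
      · exact key a c b h' h
      · exact map_vec_three_self_left _ _ _
      · rw [map_vec_three_swap_left, neg_eq_zero]
        exact key c a b h' hab
  have key2 : ∀ a b c : Fin 4, τ ![e a, e b, e c] = 0 := by
    intro a b c
    rcases lt_trichotomy a b with h | rfl | h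
    · exact key1 a b c h
    · exact map_vec_three_self_left _ _ _
    · rw [map_vec_three_swap_left, key1 b a c h, neg_zero]
  refine Eq.trans (congrArg τ ?_) (key2 (v 0) (v 1) (v 2))
  funext i
  fin_cases i <;> rfl

/-- Components of the fundamental form in an adapted frame. -/
def symplecticMatrix : Fin 4 → Fin 4 → ℝ := ![![0, 1, 0, 0], ![-1, 0, 0, 0], ![0, 0, 0, 1], ![0, 0, -1, 0]]

lemma IsAdaptedFrame.fundamental {g : V →L[ℝ] V →L[ℝ] ℝ} {J : V →L[ℝ] V} {e : Fin 4 → V}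
    (h : IsHermitianPair g J) (he : IsAdaptedFrame g J e) (i j : Fin 4) :
    g (J (e i)) (e j) = symplecticMatrix i j := by
  have h0 : J (e 0) = e 1 := he.one.symm
  have h1 : J (e 1) = -e 0 := by rw [he.one, h.sq]
  have h2 : J (e 2) = e 3 := he.three.symm
  have h3 : J (e 3) = -e 2 := by rw [he.three, h.sq]
  fin_cases i <;> simp only [Fin.zero_eta, Fin.mk_one, Fin.reduceFinMk, h0, h1, h2, h3, map_neg,
    neg_apply, he.ortho _ _] <;> fin_cases j <;> simp [symplecticMatrix]

variable {g : V →L[ℝ] V →L[ℝ] ℝ} {η : V [⋀^Fin 2]→L[ℝ] ℝ} {b e : Module.Basis (Fin 4) ℝ V}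

lemma halfSquare_vec (η : V [⋀^Fin 2]→L[ℝ] ℝ) (v : Fin 4 → V) :
    halfSquare η v = η ![v 0, v 1] * η ![v 2, v 3] - η ![v 0, v 2] * η ![v 1, v 3] +
      η ![v 0, v 3] * η ![v 1, v 2] := rfl

lemma halfSquare_frame (hη : ∀ i j, η ![e i, e j] = symplecticMatrix i j) : halfSquare η e = 1 := by
  rw [halfSquare_vec]
  simp [hη, symplecticMatrix]

lemma starAt_two_two (he : IsOrthoFrame g e) (hη : ∀ i j, η ![e i, e j] = symplecticMatrix i j)
    (α : V [⋀^Fin 2]→L[ℝ] F) (c d : Fin 4) :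
    starAt (k := 2) (l := 2) rfl g (halfSquare η) b α ![e c, e d] =
      (2 : ℝ)⁻¹ • ∑ i, ∑ j, (symplecticMatrix i j * symplecticMatrix c d -
        symplecticMatrix i c * symplecticMatrix j d + symplecticMatrix i d * symplecticMatrix j c) •
          α ![e i, e j] := by
  rw [starAt_apply_of_orthoFrame _ _ b e he, sum_fin_two_arrow]
  congr 1
  refine Finset.sum_congr rfl fun i _ => Finset.sum_congr rfl fun j _ => ?_
  congr 1
  · rw [← hη, ← hη, ← hη, ← hη, ← hη, ← hη]
    rfl
  · congr 1
    funext a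
    fin_cases a <;> rfl

lemma starAt_three_one (he : IsOrthoFrame g e) (hη : ∀ i j, η ![e i, e j] = symplecticMatrix i j)
    (α : V [⋀^Fin 3]→L[ℝ] F) (d : Fin 4) :
    starAt (k := 3) (l := 1) rfl g (halfSquare η) b α ![e d] =
      (6 : ℝ)⁻¹ • ∑ i, ∑ j, ∑ k, (symplecticMatrix i j * symplecticMatrix k d -
        symplecticMatrix i k * symplecticMatrix j d + symplecticMatrix i d * symplecticMatrix j k) •
          α ![e i, e j, e k] := by
  rw [starAt_apply_of_orthoFrame _ _ b e he, sum_fin_three_arrow]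
  congr 1
  refine Finset.sum_congr rfl fun i _ => Finset.sum_congr rfl fun j _ =>
    Finset.sum_congr rfl fun k _ => ?_
  congr 1
  · rw [← hη, ← hη, ← hη, ← hη, ← hη, ← hη]
    rfl
  · congr 1
    funext a
    fin_cases a <;> rfl

lemma starAt_two_components (he : IsOrthoFrame g e)
    (hη : ∀ i j, η ![e i, e j] = symplecticMatrix i j) (α : V [⋀^Fin 2]→L[ℝ] F) :
    starAt (k := 2) (l := 2) rfl g (halfSquare η) b α ![e 0, e 1] = α ![e 2, e 3] ∧
    starAt (k := 2) (l := 2) rfl g (halfSquare η) b α ![e 0, e 2] = -α ![e 1, e 3] ∧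
    starAt (k := 2) (l := 2) rfl g (halfSquare η) b α ![e 0, e 3] = α ![e 1, e 2] := by
  refine ⟨?_, ?_, ?_⟩
  · rw [starAt_two_two he hη, map_vec_two_swap α (e 2)]
    simp [Fin.sum_univ_four, symplecticMatrix, map_vec_two_swap α (e 3) (e 2)]
    module
  · rw [starAt_two_two he hη]
    simp [Fin.sum_univ_four, symplecticMatrix, map_vec_two_swap α (e 3) (e 1)]
    module
  · rw [starAt_two_two he hη]
    simp [Fin.sum_univ_four, symplecticMatrix, map_vec_two_swap α (e 2) (e 1)]
    module

lemma starAt_three_components (he : IsOrthoFrame g e)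
    (hη : ∀ i j, η ![e i, e j] = symplecticMatrix i j) (α : V [⋀^Fin 3]→L[ℝ] F) :
    starAt (k := 3) (l := 1) rfl g (halfSquare η) b α ![e 0] = -α ![e 1, e 2, e 3] ∧
    starAt (k := 3) (l := 1) rfl g (halfSquare η) b α ![e 1] = α ![e 0, e 2, e 3] ∧
    starAt (k := 3) (l := 1) rfl g (halfSquare η) b α ![e 2] = -α ![e 0, e 1, e 3] ∧
    starAt (k := 3) (l := 1) rfl g (halfSquare η) b α ![e 3] = α ![e 0, e 1, e 2] := by
  have hs : ∀ u v w : V, α ![v, w, u] = α ![u, v, w] ∧ α ![w, u, v] = α ![u, v, w] ∧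
      α ![v, u, w] = -α ![u, v, w] ∧ α ![u, w, v] = -α ![u, v, w] ∧
      α ![w, v, u] = -α ![u, v, w] := by
    intro u v w
    have h1 := map_vec_three_swap_left α u v w
    have h2 := map_vec_three_swap_right α u v w
    have h3 := map_vec_three_swap_left α u w v
    have h4 := map_vec_three_swap_right α v u w
    have h5 := map_vec_three_swap_left α v w u
    refine ⟨?_, ?_, ?_, ?_, ?_⟩ <;> simp_all
  refine ⟨?_, ?_, ?_, ?_⟩
  · obtain ⟨h1, h2, h3, h4, h5⟩ := hs (e 1) (e 2) (e 3)
    rw [starAt_three_one he hη]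
    simp [Fin.sum_univ_four, symplecticMatrix, h1, h2, h3, h4, h5]
    module
  · obtain ⟨h1, h2, h3, h4, h5⟩ := hs (e 0) (e 2) (e 3)
    rw [starAt_three_one he hη]
    simp [Fin.sum_univ_four, symplecticMatrix, h1, h2, h3, h4, h5]
    module
  · obtain ⟨h1, h2, h3, h4, h5⟩ := hs (e 0) (e 1) (e 3)
    rw [starAt_three_one he hη]
    simp [Fin.sum_univ_four, symplecticMatrix, h1, h2, h3, h4, h5]
    module
  · obtain ⟨h1, h2, h3, h4, h5⟩ := hs (e 0) (e 1) (e 2)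
    rw [starAt_three_one he hη]
    simp [Fin.sum_univ_four, symplecticMatrix, h1, h2, h3, h4, h5]
    module

end Components

section Wedge

variable {V : Type*} [AddCommGroup V] [Module ℝ V] [TopologicalSpace V]
variable {F : Type*} [NormedAddCommGroup F] [NormedSpace ℝ F]

/-- The wedge product of two real two-forms. -/
def wedgeTwoTwo (α β : V [⋀^Fin 2]→L[ℝ] ℝ) : V [⋀^Fin 4]→ₗ[ℝ] ℝ :=
  (halfSquare (α + β)).toAlternatingMap - (halfSquare α).toAlternatingMap -
    (halfSquare β).toAlternatingMap

lemma wedgeTwoTwo_apply (α β : V [⋀^Fin 2]→L[ℝ] ℝ) (v : Fin 4 → V) :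
    wedgeTwoTwo α β v = α ![v 0, v 1] * β ![v 2, v 3] - α ![v 0, v 2] * β ![v 1, v 3] +
      α ![v 0, v 3] * β ![v 1, v 2] + α ![v 1, v 2] * β ![v 0, v 3] -
      α ![v 1, v 3] * β ![v 0, v 2] + α ![v 2, v 3] * β ![v 0, v 1] := by
  change halfSquare (α + β) v - halfSquare α v - halfSquare β v = _
  simp only [halfSquare_vec, ContinuousAlternatingMap.add_apply]
  ring

/-- The wedge product of a real three-form and a real one-form. -/
def wedgeThreeOne (τ : V [⋀^Fin 3]→L[ℝ] ℝ) (θ : V [⋀^Fin 1]→L[ℝ] ℝ) : V [⋀^Fin 4]→ₗ[ℝ] ℝ :=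
  -AlternatingMap.alternatizeUncurryFin (LinearMap.smulRight
    ((AlternatingMap.ofSubsingleton ℝ V ℝ (0 : Fin 1)).symm θ.toAlternatingMap) τ.toAlternatingMap)

lemma wedgeThreeOne_apply (τ : V [⋀^Fin 3]→L[ℝ] ℝ) (θ : V [⋀^Fin 1]→L[ℝ] ℝ) (v : Fin 4 → V) :
    wedgeThreeOne τ θ v = τ ![v 0, v 1, v 2] * θ ![v 3] - τ ![v 0, v 1, v 3] * θ ![v 2] +
      τ ![v 0, v 2, v 3] * θ ![v 1] - τ ![v 1, v 2, v 3] * θ ![v 0] := by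
  have h1 : ∀ u : V, ((AlternatingMap.ofSubsingleton ℝ V ℝ (0 : Fin 1)).symm θ.toAlternatingMap) u
      = θ ![u] := fun u => congrArg θ (funext fun i => by fin_cases i; rfl)
  have h2 : ∀ w : Fin 3 → V, τ.toAlternatingMap w = τ ![w 0, w 1, w 2] := fun w =>
    congrArg τ (funext fun i => by fin_cases i <;> rfl)
  rw [wedgeThreeOne, AlternatingMap.neg_apply, AlternatingMap.alternatizeUncurryFin_apply,
    Fin.sum_univ_four]
  simp only [LinearMap.smulRight_apply, AlternatingMap.smul_apply, h1, h2]
  have hr : ∀ (i : Fin 4) (j : Fin 3), i.removeNth v j = v (i.succAbove j) := fun _ _ => rfl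
  simp only [hr]
  have e00 : (0 : Fin 4).succAbove (0 : Fin 3) = 1 := by decide
  have e01 : (0 : Fin 4).succAbove (1 : Fin 3) = 2 := by decide
  have e02 : (0 : Fin 4).succAbove (2 : Fin 3) = 3 := by decide
  have e10 : (1 : Fin 4).succAbove (0 : Fin 3) = 0 := by decide
  have e11 : (1 : Fin 4).succAbove (1 : Fin 3) = 2 := by decide
  have e12 : (1 : Fin 4).succAbove (2 : Fin 3) = 3 := by decide
  have e20 : (2 : Fin 4).succAbove (0 : Fin 3) = 0 := by decide
  have e21 : (2 : Fin 4).succAbove (1 : Fin 3) = 1 := by decide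
  have e22 : (2 : Fin 4).succAbove (2 : Fin 3) = 3 := by decide
  have e30 : (3 : Fin 4).succAbove (0 : Fin 3) = 0 := by decide
  have e31 : (3 : Fin 4).succAbove (1 : Fin 3) = 1 := by decide
  have e32 : (3 : Fin 4).succAbove (2 : Fin 3) = 2 := by decide
  simp only [e00, e01, e02, e10, e11, e12, e20, e21, e22, e30, e31, e32, smul_eq_mul]
  norm_num
  ring

section Hermitian

variable {g : V →L[ℝ] V →L[ℝ] ℝ} {J : V →L[ℝ] V} {η : V [⋀^Fin 2]→L[ℝ] ℝ}

lemma halfSquare_ne_zero (h : IsHermitianPair g J) (hη : ∀ u v, η ![u, v] = g (J u) v)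
    (b : Module.Basis (Fin 4) ℝ V) : halfSquare η b ≠ 0 := by
  obtain ⟨e, he⟩ := h.exists_adaptedFrame (by simp [Module.finrank_eq_card_basis b])
  have h1 := halfSquare_frame (η := η) (e := e) fun i j => by rw [hη, he.fundamental h]
  have h2 : (halfSquare η).toAlternatingMap ≠ 0 := by
    rw [← AlternatingMap.map_basis_ne_zero_iff e]
    change halfSquare η e ≠ 0
    rw [h1]
    exact one_ne_zero
  exact (AlternatingMap.map_basis_ne_zero_iff b _).2 h2

/-- Anti-self-dual two-forms are invariant under the complex structure. -/
lemma map_J_of_antiSelfDual (h : IsHermitianPair g J) (hη : ∀ u v, η ![u, v] = g (J u) v)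
    (b : Module.Basis (Fin 4) ℝ V) (α : V [⋀^Fin 2]→L[ℝ] F)
    (hα : starAt (k := 2) (l := 2) rfl g (halfSquare η) b α = -α) (u v : V) :
    α ![J u, J v] = α ![u, v] := by
  obtain ⟨e, he⟩ := h.exists_adaptedFrame (by simp [Module.finrank_eq_card_basis b])
  obtain ⟨h1, h2, h3⟩ := starAt_two_components (η := η) (b := b) he.ortho
    (fun i j => by rw [hη, he.fundamental h]) α
  rw [hα, ContinuousAlternatingMap.neg_apply] at h1 h2 h3
  have hJ0 : J (e 0) = e 1 := he.one.symm
  have hJ1 : J (e 1) = -e 0 := by rw [he.one, h.sq]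
  have hJ2 : J (e 2) = e 3 := he.three.symm
  have hJ3 : J (e 3) = -e 2 := by rw [he.three, h.sq]
  have key : ∀ i j, i < j → α ![J (e i), J (e j)] = α ![e i, e j] := by
    intro i j hij
    fin_cases i <;> fin_cases j <;> simp at hij <;>
      simp only [Fin.zero_eta, Fin.mk_one, Fin.reduceFinMk, hJ0, hJ1, hJ2, hJ3,
        map_vec_two_neg_left, map_vec_two_neg_right, ← h1, ← h3, neg_neg]
    · rw [map_vec_two_swap, neg_neg]
    · exact (neg_inj.1 h2).symm
    · rw [← neg_inj, h2]
    · rw [map_vec_two_swap, neg_neg]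
      exact h1.symm
  have : (α.compContinuousLinearMap J).toAlternatingMap = α.toAlternatingMap := by
    refine Module.Basis.ext_alternating e fun v hv => ?_
    have hv' : (fun i => e (v i)) = ![e (v 0), e (v 1)] := by
      funext i; fin_cases i <;> rfl
    have hJv : (fun i => J (e (v i))) = ![J (e (v 0)), J (e (v 1))] := by
      funext i; fin_cases i <;> rfl
    change α (fun i => J (e (v i))) = α (fun i => e (v i))
    rw [hJv, hv']
    rcases lt_trichotomy (v 0) (v 1) with hlt | heq | hlt
    · exact key _ _ hlt
    · exact absurd (hv heq) (by decide)
    · rw [map_vec_two_swap, key _ _ hlt, ← map_vec_two_swap]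
  have h' := congrArg (fun f : V [⋀^Fin 2]→ₗ[ℝ] F => f ![u, v]) this
  refine Eq.trans (congrArg α ?_) h'
  funext i
  fin_cases i <;> rfl

lemma wedgeTwoTwo_eq_zero (h : IsHermitianPair g J) (hη : ∀ u v, η ![u, v] = g (J u) v)
    (b : Module.Basis (Fin 4) ℝ V) {α β : V [⋀^Fin 2]→L[ℝ] ℝ}
    (hα : starAt (k := 2) (l := 2) rfl g (halfSquare η) b α = -α)
    (hβ : starAt (k := 2) (l := 2) rfl g (halfSquare η) b β = β) : wedgeTwoTwo α β = 0 := by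
  obtain ⟨e, he⟩ := h.exists_adaptedFrame (by simp [Module.finrank_eq_card_basis b])
  have hη' : ∀ i j, η ![e i, e j] = symplecticMatrix i j := fun i j => by
    rw [hη, he.fundamental h]
  obtain ⟨h1, h2, h3⟩ := starAt_two_components (b := b) he.ortho hη' α
  obtain ⟨k1, k2, k3⟩ := starAt_two_components (b := b) he.ortho hη' β
  rw [hα, ContinuousAlternatingMap.neg_apply] at h1 h2 h3
  rw [hβ] at k1 k2 k3
  rw [← AlternatingMap.map_basis_eq_zero_iff e, wedgeTwoTwo_apply, ← h1, ← h3, k1, k2, k3,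
    ← neg_inj.1 h2]
  ring

lemma exists_wedgeThreeOne_star (h : IsHermitianPair g J) (hη : ∀ u v, η ![u, v] = g (J u) v)
    (b : Module.Basis (Fin 4) ℝ V) (τ : V [⋀^Fin 3]→L[ℝ] ℝ) :
    ∃ c : ℝ, 0 ≤ c ∧ (c = 0 → τ = 0) ∧
      wedgeThreeOne τ (starAt (k := 3) (l := 1) rfl g (halfSquare η) b τ) =
        c • (halfSquare η).toAlternatingMap := by
  obtain ⟨e, he⟩ := h.exists_adaptedFrame (by simp [Module.finrank_eq_card_basis b])
  have hη' : ∀ i j, η ![e i, e j] = symplecticMatrix i j := fun i j => by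
    rw [hη, he.fundamental h]
  obtain ⟨h0, h1, h2, h3⟩ := starAt_three_components (b := b) he.ortho hη' τ
  refine ⟨τ ![e 0, e 1, e 2] ^ 2 + τ ![e 0, e 1, e 3] ^ 2 + τ ![e 0, e 2, e 3] ^ 2 +
    τ ![e 1, e 2, e 3] ^ 2, by positivity, fun hc => ?_, ?_⟩
  · apply three_form_eq_zero e <;> nlinarith [sq_nonneg (τ ![e 0, e 1, e 2]),
      sq_nonneg (τ ![e 0, e 1, e 3]), sq_nonneg (τ ![e 0, e 2, e 3]),
      sq_nonneg (τ ![e 1, e 2, e 3])]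
  · rw [← sub_eq_zero, ← AlternatingMap.map_basis_eq_zero_iff e, AlternatingMap.sub_apply,
      AlternatingMap.smul_apply, wedgeThreeOne_apply, h0, h1, h2, h3]
    have : (halfSquare η).toAlternatingMap e = 1 := halfSquare_frame hη'
    rw [this, smul_eq_mul]
    ring

end Hermitian

/-! ### Bidegrees of two-forms -/

lemma bidegreePart_apply {k : ℕ} (J : V →L[ℝ] V) (p q : ℕ) (α : V [⋀^Fin k]→L[ℝ] ℂ)
    (v : Fin k → V) : bidegreePart J p q α v =
      ∑ S : Finset (Fin k) with S.card = p ∧ Sᶜ.card = q, slotPart J S α v := by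
  change (∑ S : Finset (Fin k) with S.card = p ∧ Sᶜ.card = q, slotPart J S α) v = _
  rw [sum_apply]

lemma slotPart_two_apply (J : V →L[ℝ] V) (S : Finset (Fin 2)) (α : V [⋀^Fin 2]→L[ℝ] ℂ) (u v : V) :
    slotPart J S α ![u, v] = (1 / 4 : ℂ) * (α ![u, v] +
      (if 0 ∈ S then -Complex.I else Complex.I) * α ![J u, v] +
      (if 1 ∈ S then -Complex.I else Complex.I) * α ![u, J v] +
      (if 0 ∈ S then -Complex.I else Complex.I) * (if 1 ∈ S then -Complex.I else Complex.I) *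
        α ![J u, J v]) := by
  have huniv : (Finset.univ : Finset (Finset (Fin 2))) = {∅, {0}, {1}, {0, 1}} := by decide
  have hα : ∀ T : Finset (Fin 2), (α.toContinuousMultilinearMap.compContinuousLinearMap
      (fun i => if i ∈ T then J else ContinuousLinearMap.id ℝ V)) ![u, v] =
      α ![if 0 ∈ T then J u else u, if 1 ∈ T then J v else v] := by
    intro T
    refine congrArg α ?_
    funext i
    fin_cases i
    · by_cases h : (0 : Fin 2) ∈ T <;> simp [h]
    · by_cases h : (1 : Fin 2) ∈ T <;> simp [h]
  simp only [slotPart, smul_apply, sum_apply, hα, huniv]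
  rw [Finset.sum_insert (by decide), Finset.sum_insert (by decide), Finset.sum_insert (by decide),
    Finset.sum_singleton, Finset.prod_pair (by decide)]
  simp
  ring

lemma bidegreePart_one_one_apply (J : V →L[ℝ] V) (α : V [⋀^Fin 2]→L[ℝ] ℂ) (u v : V) :
    bidegreePart J 1 1 α ![u, v] = (1 / 2 : ℂ) * (α ![u, v] + α ![J u, J v]) := by
  have hf : (Finset.univ.filter fun S : Finset (Fin 2) => S.card = 1 ∧ Sᶜ.card = 1)
      = {{0}, {1}} := by decide
  rw [bidegreePart_apply, hf, Finset.sum_pair (by decide), slotPart_two_apply, slotPart_two_apply]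
  simp
  ring

lemma eq_vec_two {W : Type*} (v : Fin 2 → W) : v = ![v 0, v 1] := by
  funext i; fin_cases i <;> rfl

lemma bidegreePart_one_one_eq_self_iff {J : V →L[ℝ] V} (α : V [⋀^Fin 2]→L[ℝ] ℂ) :
    bidegreePart J 1 1 α = α ↔ ∀ u v, α ![J u, J v] = α ![u, v] := by
  constructor
  · intro h u v
    have := congrArg (fun f : V [⋀^Fin 2]→L[ℝ] ℂ => f ![u, v]) h
    simp only [bidegreePart_one_one_apply] at this
    linear_combination 2 * this
  · intro h
    ext v
    rw [eq_vec_two v, bidegreePart_one_one_apply, h]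
    ring

lemma bidegreePart_eq_zero_of_one_one {J : V →L[ℝ] V} (hJ : ∀ v, J (J v) = -v)
    {α : V [⋀^Fin 2]→L[ℝ] ℂ} (hα : bidegreePart J 1 1 α = α) {p q : ℕ} (hpq : p ≠ 1 ∨ q ≠ 1) :
    bidegreePart J p q α = 0 := by
  rw [bidegreePart_one_one_eq_self_iff] at hα
  have hl : ∀ u v, α ![J u, v] = -α ![u, J v] := by
    intro u v
    rw [← hα u (J v), hJ, map_vec_two_neg_right, neg_neg]
  ext v
  rw [eq_vec_two v, bidegreePart_apply]
  refine Finset.sum_eq_zero fun S hS => ?_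
  rw [Finset.mem_filter] at hS
  rw [slotPart_two_apply, hα, hl]
  have hcases : ∀ S : Finset (Fin 2), S = ∅ ∨ S = {0} ∨ S = {1} ∨ S = {0, 1} := by decide
  rcases hcases S with rfl | rfl | rfl | rfl
  · simp
  · exact absurd hS.2 (by simp [Finset.card_compl]; omega)
  · exact absurd hS.2 (by simp [Finset.card_compl]; omega)
  · simp

lemma bidegreePart_zero {k : ℕ} (J : V →L[ℝ] V) (p q : ℕ) :
    bidegreePart J p q (0 : V [⋀^Fin k]→L[ℝ] ℂ) = 0 := by
  ext v
  rw [bidegreePart_apply]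
  simp [slotPart]

end Wedge

set_option synthInstance.maxHeartbeats 400000 in
lemma contDiffOn_extDeriv {E F : Type*} [NormedAddCommGroup E] [NormedSpace ℝ E]
    [NormedAddCommGroup F] [NormedSpace ℝ F] {k : ℕ} {s : Set E} (hs : IsOpen s)
    {β : E → E [⋀^Fin k]→L[ℝ] F} (h : ContDiffOn ℝ ∞ β s) : ContDiffOn ℝ ∞ (extDeriv β) s :=
  (ContinuousAlternatingMap.alternatizeUncurryFinCLM ℝ E F (n := k)).contDiff.comp_contDiffOn
    (h.fderiv_of_isOpen hs le_rfl)

section Charts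

variable {X : Type*} [TopologicalSpace X] [ChartedSpace E4 X]
variable {F : Type*} [NormedAddCommGroup F] [NormedSpace ℝ F] {k : ℕ}

/-- The derivative of the inverse of the preferred chart at `x₀`. -/
def chartDeriv (x₀ : X) (y : E4) : E4 →L[ℝ] E4 :=
  mfderiv 𝓘(ℝ, E4) (𝓡 4) (extChartAt (𝓡 4) x₀).symm y

/-- The change of coordinates between the preferred charts at two points. -/
def transition (x₀ x₁ : X) : E4 → E4 := extChartAt (𝓡 4) x₁ ∘ (extChartAt (𝓡 4) x₀).symm

/-- The domain of the change of coordinates between the preferred charts at two points. -/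
def overlap (x₀ x₁ : X) : Set E4 :=
  (extChartAt (𝓡 4) x₀).target ∩ (extChartAt (𝓡 4) x₀).symm ⁻¹' (extChartAt (𝓡 4) x₁).source

lemma isOpen_overlap (x₀ x₁ : X) : IsOpen (overlap x₀ x₁) :=
  (continuousOn_extChartAt_symm x₀).isOpen_inter_preimage (isOpen_extChartAt_target x₀)
    (isOpen_extChartAt_source x₁)

/-- The value of a form at a point, as an alternating form on the model space. -/
def valueAt (α : Form X k F) (x : X) : E4 [⋀^Fin k]→L[ℝ] F := α x

lemma inChart_eq (α : Form X k F) (x₀ : X) (y : E4) :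
    inChart α x₀ y =
      (valueAt α ((extChartAt (𝓡 4) x₀).symm y)).compContinuousLinearMap (chartDeriv x₀ y) := rfl

variable [IsManifold (𝓡 4) ∞ X]

lemma contDiffOn_transition (x₀ x₁ : X) :
    ContDiffOn ℝ ∞ (transition x₀ x₁) (overlap x₀ x₁) := by
  refine (contDiffOn_ext_coord_change (I := 𝓡 4) (n := ∞) x₁ x₀).mono fun y hy => ?_
  rw [PartialEquiv.trans_source]
  exact hy

lemma mdifferentiableAt_extChartAt_symm_of_mem (x₀ : X) {y : E4}
    (hy : y ∈ (extChartAt (𝓡 4) x₀).target) :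
    MDifferentiableAt 𝓘(ℝ, E4) (𝓡 4) (extChartAt (𝓡 4) x₀).symm y := by
  have : IsManifold (𝓡 4) 1 X := IsManifold.of_le (n := ∞) (by simp)
  have := mdifferentiableWithinAt_extChartAt_symm (I := 𝓡 4) hy
  rwa [(𝓡 4).range_eq_univ, mdifferentiableWithinAt_univ] at this

lemma chartDeriv_eq_comp (x₀ x₁ : X) {y : E4} (hy : y ∈ overlap x₀ x₁) :
    chartDeriv x₀ y = (chartDeriv x₁ (transition x₀ x₁ y)).comp (fderiv ℝ (transition x₀ x₁) y) := by
  have hd : DifferentiableAt ℝ (transition x₀ x₁) y :=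
    ((contDiffOn_transition x₀ x₁).contDiffAt ((isOpen_overlap x₀ x₁).mem_nhds hy)).differentiableAt
      (by simp)
  have ht : transition x₀ x₁ y ∈ (extChartAt (𝓡 4) x₁).target :=
    (extChartAt (𝓡 4) x₁).map_source hy.2
  have h1 := mfderiv_comp (I := 𝓘(ℝ, E4)) (I' := 𝓘(ℝ, E4)) (I'' := 𝓡 4) y
    (mdifferentiableAt_extChartAt_symm_of_mem x₁ ht) hd.mdifferentiableAt
  rw [mfderiv_eq_fderiv] at h1
  refine Eq.trans ?_ h1
  unfold chartDeriv
  apply Filter.EventuallyEq.mfderiv_eq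
  filter_upwards [(isOpen_overlap x₀ x₁).mem_nhds hy] with z hz
  exact ((extChartAt (𝓡 4) x₁).left_inv hz.2).symm

lemma chartDeriv_self (x : X) : chartDeriv x (extChartAt (𝓡 4) x x) = ContinuousLinearMap.id ℝ E4 := by
  have : IsManifold (𝓡 4) 1 X := IsManifold.of_le (n := ∞) (by simp)
  have := mfderivWithin_range_extChartAt_symm (I := 𝓡 4) (x := x)
  rw [(𝓡 4).range_eq_univ, mfderivWithin_univ] at this
  exact this

lemma inChart_eq_pullback (α : Form X k F) (x₀ x₁ : X) {y : E4} (hy : y ∈ overlap x₀ x₁) :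
    inChart α x₀ y =
      (inChart α x₁ (transition x₀ x₁ y)).compContinuousLinearMap (fderiv ℝ (transition x₀ x₁) y) := by
  have h1 : (extChartAt (𝓡 4) x₁).symm (transition x₀ x₁ y) = (extChartAt (𝓡 4) x₀).symm y :=
    (extChartAt (𝓡 4) x₁).left_inv hy.2
  rw [inChart_eq, inChart_eq, h1, chartDeriv_eq_comp x₀ x₁ hy]
  rfl

lemma valueAt_extD (α : Form X k F) (x : X) :
    valueAt (extD α) x = extDeriv (inChart α x) (extChartAt (𝓡 4) x x) := by
  have : IsManifold (𝓡 4) 1 X := IsManifold.of_le (n := ∞) (by simp)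
  have h := mfderiv_extChartAt_self (I := 𝓡 4) (x := x)
  unfold valueAt extD
  rw [h]
  rfl

/-- In every chart, the exterior derivative is the exterior derivative of the local expression. -/
lemma inChart_extD {α : Form X k F} (hα : IsSmooth α) (x₀ : X) {y : E4}
    (hy : y ∈ (extChartAt (𝓡 4) x₀).target) :
    inChart (extD α) x₀ y = extDeriv (inChart α x₀) y := by
  set x := (extChartAt (𝓡 4) x₀).symm y with hx
  have hyo : y ∈ overlap x₀ x := ⟨hy, mem_extChartAt_source x⟩
  have ht : transition x₀ x y = extChartAt (𝓡 4) x x := rfl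
  have hpull : inChart α x₀ =ᶠ[nhds y] fun z =>
      (inChart α x (transition x₀ x z)).compContinuousLinearMap (fderiv ℝ (transition x₀ x) z) := by
    filter_upwards [(isOpen_overlap x₀ x).mem_nhds hyo] with z hz
    exact inChart_eq_pullback α x₀ x hz
  have hd : DifferentiableAt ℝ (inChart α x) (transition x₀ x y) :=
    ((hα x).contDiffAt ((isOpen_extChartAt_target x).mem_nhds (by
      rw [ht]; exact mem_extChartAt_target x))).differentiableAt (by simp)
  rw [hpull.extDeriv_eq, extDeriv_pullback hd
    ((contDiffOn_transition x₀ x).contDiffAt ((isOpen_overlap x₀ x).mem_nhds hyo))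
      (by rw [minSmoothness_of_isRCLikeNormedField]; exact WithTop.coe_le_coe.2 le_top), inChart_eq, ← hx, valueAt_extD,
      chartDeriv_eq_comp x₀ x hyo, ht, chartDeriv_self, ContinuousLinearMap.id_comp]

lemma IsSmooth.extD {α : Form X k F} (hα : IsSmooth α) : IsSmooth (extD α) := fun x₀ =>
  (contDiffOn_extDeriv (isOpen_extChartAt_target x₀) (hα x₀)).congr fun _ hy =>
    inChart_extD hα x₀ hy

omit [IsManifold (𝓡 4) ∞ X] in
lemma IsSmooth.neg {α : Form X k F} (hα : IsSmooth α) : IsSmooth (-α) := fun x₀ => (hα x₀).neg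

omit [IsManifold (𝓡 4) ∞ X] in
lemma IsSmooth.add {α β : Form X k F} (hα : IsSmooth α) (hβ : IsSmooth β) : IsSmooth (α + β) :=
  fun x₀ => (hα x₀).add (hβ x₀)

omit [IsManifold (𝓡 4) ∞ X] in
lemma isSmooth_zero : IsSmooth (0 : Form X k F) := fun _ => contDiffOn_const (c := 0)

omit [IsManifold (𝓡 4) ∞ X] in
lemma IsSmooth.differentiableAt_inChart {α : Form X k F} (hα : IsSmooth α) (x₀ : X) {y : E4}
    (hy : y ∈ (extChartAt (𝓡 4) x₀).target) : DifferentiableAt ℝ (inChart α x₀) y :=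
  ((hα x₀).contDiffAt ((isOpen_extChartAt_target x₀).mem_nhds hy)).differentiableAt (by simp)

lemma extD_add {α β : Form X k F} (hα : IsSmooth α) (hβ : IsSmooth β) :
    extD (α + β) = extD α + extD β := by
  funext x
  change valueAt (extD (α + β)) x = valueAt (extD α) x + valueAt (extD β) x
  rw [valueAt_extD, valueAt_extD, valueAt_extD]
  exact extDeriv_add (hα.differentiableAt_inChart x (mem_extChartAt_target x))
    (hβ.differentiableAt_inChart x (mem_extChartAt_target x))

lemma extD_neg (α : Form X k F) : extD (-α) = -extD α := by
  funext x
  have : inChart (-α) x = (-1 : ℝ) • inChart α x := by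
    funext y
    rw [Pi.smul_apply, neg_one_smul]
    rfl
  change valueAt (extD (-α)) x = -valueAt (extD α) x
  rw [valueAt_extD, valueAt_extD, this, extDeriv_smul, neg_one_smul]

lemma extD_zero : extD (0 : Form X k F) = 0 := by
  funext x
  have : inChart (0 : Form X k F) x = (0 : ℝ) • inChart (0 : Form X k F) x := by
    funext y
    rw [Pi.smul_apply, zero_smul]
    rfl
  change valueAt (extD (0 : Form X k F)) x = 0
  rw [valueAt_extD, this, extDeriv_smul, zero_smul]

/-- Composition of a form with a linear map of the values. -/
def mapForm {G : Type*} [NormedAddCommGroup G] [NormedSpace ℝ G] (L : F →L[ℝ] G)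
    (α : Form X k F) : Form X k G := fun x => L.compContinuousAlternatingMap (α x)

section MapForm

variable {G : Type*} [NormedAddCommGroup G] [NormedSpace ℝ G] (L : F →L[ℝ] G)

omit [IsManifold (𝓡 4) ∞ X] in
lemma IsSmooth.mapForm {α : Form X k F} (hα : IsSmooth α) : IsSmooth (mapForm L α) := fun x₀ =>
  (ContinuousLinearMap.compContinuousAlternatingMapCLM ℝ E4 F G (Fin k) L).contDiff.comp_contDiffOn (hα x₀)

lemma extD_mapForm {α : Form X k F} (hα : IsSmooth α) :
    extD (AlmostHermitian.mapForm L α) = AlmostHermitian.mapForm L (extD α) := by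
  funext x
  have hd := hα.differentiableAt_inChart x (mem_extChartAt_target x)
  change valueAt (extD (AlmostHermitian.mapForm L α)) x =
    L.compContinuousAlternatingMap (valueAt (extD α) x)
  rw [valueAt_extD, valueAt_extD]
  have h2 : fderiv ℝ (inChart (AlmostHermitian.mapForm L α) x) (extChartAt (𝓡 4) x x) =
      (ContinuousLinearMap.compContinuousAlternatingMapCLM ℝ E4 F G (Fin k) L).comp
        (fderiv ℝ (inChart α x) (extChartAt (𝓡 4) x x)) :=
    ((ContinuousLinearMap.compContinuousAlternatingMapCLM ℝ E4 F G (Fin k) L).hasFDerivAt.comp _ hd.hasFDerivAt).fderiv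
  ext v
  rw [extDeriv, h2, extDeriv, ContinuousAlternatingMap.alternatizeUncurryFin_apply,
    L.compContinuousAlternatingMap_coe, Function.comp_apply,
    ContinuousAlternatingMap.alternatizeUncurryFin_apply, map_sum]
  refine Finset.sum_congr rfl fun i _ => ?_
  simp [← Int.cast_smul_eq_zsmul ℝ]

end MapForm

end Charts

section Metric

variable {X : Type*} [TopologicalSpace X] [ChartedSpace E4 X] [IsManifold (𝓡 4) ∞ X]
variable {F : Type*} [NormedAddCommGroup F] [NormedSpace ℝ F] {k : ℕ}

/-- The coordinate vector field `u` of the chart at `x₀` is smooth. -/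
lemma contMDiffOn_chartDeriv (x₀ : X) (u : E4) :
    ContMDiffOn 𝓘(ℝ, E4) ((𝓡 4).prod 𝓘(ℝ, E4)) ∞
      (fun y => Bundle.TotalSpace.mk' E4 (E := fun x : X => TangentSpace (𝓡 4) x)
        ((extChartAt (𝓡 4) x₀).symm y) (chartDeriv x₀ y u)) (extChartAt (𝓡 4) x₀).target := by
  have hopen : IsOpen (extChartAt (𝓡 4) x₀).target := isOpen_extChartAt_target x₀
  have h1 := (contMDiffOn_extChartAt_symm (I := 𝓡 4) (n := ∞) x₀).contMDiffOn_tangentMapWithin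
    (m := ∞) (by simp) hopen.uniqueMDiffOn
  have h2 : ContMDiff 𝓘(ℝ, E4) (𝓘(ℝ, E4).tangent) ∞
      (fun y : E4 => (⟨y, u⟩ : TangentBundle 𝓘(ℝ, E4) E4)) :=
    contMDiff_vectorSpace_iff_contDiff.2 contDiff_const
  refine (h1.comp h2.contMDiffOn (s := (extChartAt (𝓡 4) x₀).target) fun y hy => hy).congr ?_
  intro y hy
  simp only [Function.comp_apply, tangentMapWithin, mfderivWithin_of_isOpen hopen hy]
  rfl

variable {J : AlmostComplexStructure X} (g : HermitianMetric J)

/-- The almost-complex structure at a point, as an endomorphism of the model space. -/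
def AlmostComplexStructure.valueAt (J : AlmostComplexStructure X) (x : X) : E4 →L[ℝ] E4 := J.toFun x

/-- The metric at a point, as a bilinear form on the model space. -/
def HermitianMetric.valueAt (x : X) : E4 →L[ℝ] E4 →L[ℝ] ℝ := g.inner x

lemma HermitianMetric.isHermitianPair (x : X) : IsHermitianPair (g.valueAt x) (J.valueAt x) where
  symm := g.symm x
  pos := g.pos x
  sq := J.sq x
  inner_J := g.inner_J x

lemma HermitianMetric.contDiffOn_inner (x₀ : X) (u v : E4) :
    ContDiffOn ℝ ∞ (fun y => g.valueAt ((extChartAt (𝓡 4) x₀).symm y)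
      (chartDeriv x₀ y u) (chartDeriv x₀ y v)) (extChartAt (𝓡 4) x₀).target := by
  have hg := g.contMDiff.comp_contMDiffOn (contMDiffOn_extChartAt_symm (I := 𝓡 4) (n := ∞) x₀)
  have h := ContMDiffOn.clm_bundle_apply₂ (E₃ := Bundle.Trivial X ℝ) (F₃ := ℝ) hg
    (contMDiffOn_chartDeriv x₀ u) (contMDiffOn_chartDeriv x₀ v)
  rw [← contMDiffOn_iff_contDiffOn]
  intro y hy
  have := h y hy
  rw [Bundle.contMDiffWithinAt_totalSpace] at this
  exact this.2

lemma HermitianMetric.contDiffOn_inner_J (x₀ : X) (u v : E4) :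
    ContDiffOn ℝ ∞ (fun y => g.valueAt ((extChartAt (𝓡 4) x₀).symm y)
      (J.valueAt ((extChartAt (𝓡 4) x₀).symm y) (chartDeriv x₀ y u)) (chartDeriv x₀ y v))
      (extChartAt (𝓡 4) x₀).target := by
  have hg := g.contMDiff.comp_contMDiffOn (contMDiffOn_extChartAt_symm (I := 𝓡 4) (n := ∞) x₀)
  have hJ := J.contMDiff.comp_contMDiffOn (contMDiffOn_extChartAt_symm (I := 𝓡 4) (n := ∞) x₀)
  have hJu := ContMDiffOn.clm_bundle_apply hJ (contMDiffOn_chartDeriv x₀ u)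
  have h := ContMDiffOn.clm_bundle_apply₂ (E₃ := Bundle.Trivial X ℝ) (F₃ := ℝ) hg
    hJu (contMDiffOn_chartDeriv x₀ v)
  rw [← contMDiffOn_iff_contDiffOn]
  intro y hy
  have := h y hy
  rw [Bundle.contMDiffWithinAt_totalSpace] at this
  exact this.2

/-- The standard basis of the model space. -/
def stdBasis : Module.Basis (Fin 4) ℝ E4 := (EuclideanSpace.basisFun (Fin 4) ℝ).toBasis

lemma stdBasis_apply (i : Fin 4) : stdBasis i = EuclideanSpace.single i (1 : ℝ) := by
  simp [stdBasis]

lemma HermitianMetric.valueAt_fundamentalForm (x : X) (u v : E4) :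
    AlmostHermitian.valueAt g.fundamentalForm x ![u, v] = g.valueAt x (J.valueAt x u) v := rfl

lemma HermitianMetric.valueAt_star {l : ℕ} (h : k + l = 4) (α : Form X k F) (x : X) :
    AlmostHermitian.valueAt (g.star h α) x = starAt h (g.valueAt x)
      (halfSquare (AlmostHermitian.valueAt g.fundamentalForm x)) stdBasis
        (AlmostHermitian.valueAt α x) := by
  have : ⇑stdBasis = fun i => (EuclideanSpace.single i (1 : ℝ) : E4) := funext stdBasis_apply
  rw [this]
  rfl

lemma bijective_chartDeriv (x₀ : X) {y : E4} (hy : y ∈ (extChartAt (𝓡 4) x₀).target) :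
    Function.Bijective (chartDeriv x₀ y) := by
  have : IsManifold (𝓡 4) 1 X := IsManifold.of_le (n := ∞) (by simp)
  have h := isInvertible_mfderivWithin_extChartAt_symm (I := 𝓡 4) hy
  rw [(𝓡 4).range_eq_univ, mfderivWithin_univ] at h
  exact h.bijective

/-- The coordinate frame of the chart at `x₀`. -/
def chartFrame (x₀ : X) {y : E4} (hy : y ∈ (extChartAt (𝓡 4) x₀).target) :
    Module.Basis (Fin 4) ℝ E4 :=
  stdBasis.map (LinearEquiv.ofBijective (chartDeriv x₀ y).toLinearMap (bijective_chartDeriv x₀ hy))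

lemma chartFrame_apply (x₀ : X) {y : E4} (hy : y ∈ (extChartAt (𝓡 4) x₀).target) (i : Fin 4) :
    chartFrame x₀ hy i = chartDeriv x₀ y (stdBasis i) := rfl

/-- The coefficient of the volume form in the chart at `x₀`. -/
def HermitianMetric.density (x₀ : X) (y : E4) : ℝ :=
  halfSquare (AlmostHermitian.valueAt g.fundamentalForm ((extChartAt (𝓡 4) x₀).symm y))
    fun i => chartDeriv x₀ y (stdBasis i)

lemma HermitianMetric.contDiffOn_density (x₀ : X) :
    ContDiffOn ℝ ∞ (g.density x₀) (extChartAt (𝓡 4) x₀).target := by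
  have h := fun i j => g.contDiffOn_inner_J x₀ (stdBasis i) (stdBasis j)
  exact (((h 0 1).mul (h 2 3)).sub ((h 0 2).mul (h 1 3))).add ((h 0 3).mul (h 1 2))

lemma HermitianMetric.density_ne_zero (x₀ : X) {y : E4}
    (hy : y ∈ (extChartAt (𝓡 4) x₀).target) : g.density x₀ y ≠ 0 :=
  halfSquare_ne_zero (g.isHermitianPair _) (g.valueAt_fundamentalForm _) (chartFrame x₀ hy)

end Metric

section MatrixSmooth

variable {E : Type*} [NormedAddCommGroup E] [NormedSpace ℝ E] {n : ℕ} {s : Set E}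
  {A : E → Matrix (Fin n) (Fin n) ℝ}

lemma contDiffOn_det (hA : ∀ i j, ContDiffOn ℝ ∞ (fun y => A y i j) s) :
    ContDiffOn ℝ ∞ (fun y => (A y).det) s := by
  simp only [Matrix.det_apply]
  exact ContDiffOn.sum fun σ _ => (contDiffOn_prod fun i _ => hA _ _).const_smul _

lemma contDiffOn_matrix_inv (hA : ∀ i j, ContDiffOn ℝ ∞ (fun y => A y i j) s)
    (hdet : ∀ y ∈ s, (A y).det ≠ 0) (i j : Fin n) : ContDiffOn ℝ ∞ (fun y => (A y)⁻¹ i j) s := by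
  have h1 : ∀ y ∈ s, (A y)⁻¹ i j = ((A y).det)⁻¹ * ((A y).updateRow j (Pi.single i 1)).det := by
    intro y _
    rw [Matrix.inv_def, Matrix.smul_apply, Ring.inverse_eq_inv', Matrix.adjugate_apply, smul_eq_mul]
  refine (((contDiffOn_det hA).inv hdet).mul (contDiffOn_det fun a c => ?_)).congr h1
  by_cases h : a = j
  · subst h
    simpa using contDiffOn_const
  · simpa [Matrix.updateRow_ne h] using hA a c

end MatrixSmooth

section StarSmooth

variable {X : Type*} [TopologicalSpace X] [ChartedSpace E4 X] [IsManifold (𝓡 4) ∞ X]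
variable {F : Type*} [NormedAddCommGroup F] [NormedSpace ℝ F] {k : ℕ}
variable {J : AlmostComplexStructure X} (g : HermitianMetric J)

/-- The Gram matrix of the metric in the chart at `x₀`. -/
def HermitianMetric.gram (x₀ : X) (y : E4) : Matrix (Fin 4) (Fin 4) ℝ :=
  Matrix.of fun a c => g.valueAt ((extChartAt (𝓡 4) x₀).symm y)
    (chartDeriv x₀ y (stdBasis a)) (chartDeriv x₀ y (stdBasis c))

lemma HermitianMetric.exists_adaptedFrame (x : X) : ∃ e : Module.Basis (Fin 4) ℝ E4,
    IsAdaptedFrame (g.valueAt x) (J.valueAt x) e :=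
  (g.isHermitianPair x).exists_adaptedFrame (by simp)

lemma HermitianMetric.contDiffOn_gram_inv (x₀ : X) (i j : Fin 4) :
    ContDiffOn ℝ ∞ (fun y => (g.gram x₀ y)⁻¹ i j) (extChartAt (𝓡 4) x₀).target := by
  refine contDiffOn_matrix_inv (fun i j => g.contDiffOn_inner x₀ _ _) (fun y hy => ?_) i j
  obtain ⟨e, he⟩ := g.exists_adaptedFrame ((extChartAt (𝓡 4) x₀).symm y)
  exact (Matrix.isUnit_det_of_left_inverse (gram_left_inv (chartFrame x₀ hy) e he.ortho)).ne_zero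

/-- The volume form in the chart at `x₀`. -/
def HermitianMetric.volumeInChart (x₀ : X) (y : E4) : E4 [⋀^Fin 4]→L[ℝ] ℝ :=
  (halfSquare (AlmostHermitian.valueAt g.fundamentalForm
    ((extChartAt (𝓡 4) x₀).symm y))).compContinuousLinearMap (chartDeriv x₀ y)

lemma HermitianMetric.volumeInChart_eq (x₀ : X) {y z : E4}
    (hz : z ∈ (extChartAt (𝓡 4) x₀).target) :
    g.volumeInChart x₀ y = (g.density x₀ y / g.density x₀ z) • g.volumeInChart x₀ z := by
  apply ContinuousAlternatingMap.toAlternatingMap_injective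
  have h1 := (g.volumeInChart x₀ y).toAlternatingMap.eq_smul_basis_det stdBasis
  have h2 := (g.volumeInChart x₀ z).toAlternatingMap.eq_smul_basis_det stdBasis
  rw [ContinuousAlternatingMap.toAlternatingMap_smul, h1, h2, smul_smul]
  congr 1
  change g.density x₀ y = g.density x₀ y / g.density x₀ z * g.density x₀ z
  rw [div_mul_cancel₀ _ (g.density_ne_zero x₀ hz)]

/-- The star operator in a chart. -/
lemma HermitianMetric.inChart_star_apply {l : ℕ} (h : k + l = 4) (α : Form X k F) (x₀ : X) {y : E4}
    (hy : y ∈ (extChartAt (𝓡 4) x₀).target) (v : Fin l → E4) :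
    inChart (g.star h α) x₀ y v = ((k.factorial : ℝ)⁻¹) • ∑ i : Fin k → Fin 4,
      contract h (fun a => stdBasis (i a)) (g.volumeInChart x₀ y) v •
        ∑ r : Fin k → Fin 4, (∏ a, (g.gram x₀ y)⁻¹ (i a) (r a)) •
          inChart α x₀ y (fun a => stdBasis (r a)) := by
  set x := (extChartAt (𝓡 4) x₀).symm y with hx
  obtain ⟨e, he⟩ := g.exists_adaptedFrame x
  rw [inChart_eq, ContinuousAlternatingMap.compContinuousLinearMap_apply, ← hx, g.valueAt_star,
    starAt_apply_of_orthoFrame h _ stdBasis e he.ortho,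
    ← starAt_apply_of_orthoFrame h _ (chartFrame x₀ hy) e he.ortho, starAt_apply]
  congr 1
  refine Finset.sum_congr rfl fun i _ => ?_
  congr 1
  · rw [contract_apply, contract_apply]
    rw [HermitianMetric.volumeInChart, ContinuousAlternatingMap.compContinuousLinearMap_apply]
    congr 1
    funext a
    rw [Function.comp_apply]
    generalize Fin.cast h.symm a = c
    induction c using Fin.addCases <;> simp [chartFrame_apply]
  · have : (fun a => metricDual (g.valueAt x) (chartFrame x₀ hy) (i a)) =
        fun a => ∑ c, (g.gram x₀ y)⁻¹ (i a) c • chartDeriv x₀ y (stdBasis c) := rfl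
    rw [this]
    refine (AlmostHermitian.valueAt α x).toMultilinearMap.map_sum
      (fun a c => (g.gram x₀ y)⁻¹ (i a) c • chartDeriv x₀ y (stdBasis c)) |>.trans ?_
    exact Finset.sum_congr rfl fun r _ =>
      (AlmostHermitian.valueAt α x).toMultilinearMap.map_smul_univ _ _

/-- The linear map taking a value to the constant form with that value, a multiple of `β`. -/
def smulRightCLM {l : ℕ} (β : E4 [⋀^Fin l]→L[ℝ] ℝ) : F →L[ℝ] (E4 [⋀^Fin l]→L[ℝ] F) :=
  ((ContinuousLinearMap.compContinuousAlternatingMapCLM ℝ E4 ℝ F (Fin l)).flip β).comp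
    (ContinuousLinearMap.toSpanSingletonCLE (𝕜 := ℝ) (E := F) : F →L[ℝ] (ℝ →L[ℝ] F))

lemma smulRightCLM_apply {l : ℕ} (β : E4 [⋀^Fin l]→L[ℝ] ℝ) (z : F) (v : Fin l → E4) :
    smulRightCLM β z v = β v • z := rfl

omit [IsManifold (𝓡 4) ∞ X] in
lemma IsSmooth.contDiffOn_apply {α : Form X k F} (hα : IsSmooth α) (x₀ : X) (v : Fin k → E4) :
    ContDiffOn ℝ ∞ (fun y => inChart α x₀ y v) (extChartAt (𝓡 4) x₀).target :=
  (ContinuousAlternatingMap.apply ℝ E4 F v).contDiff.comp_contDiffOn (hα x₀)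

lemma IsSmooth.star {l : ℕ} (h : k + l = 4) {α : Form X k F} (hα : IsSmooth α) :
    IsSmooth (g.star h α) := by
  intro x₀
  set z := extChartAt (𝓡 4) x₀ x₀
  have hz : z ∈ (extChartAt (𝓡 4) x₀).target := mem_extChartAt_target x₀
  have key : ContDiffOn ℝ ∞ (fun y => ((k.factorial : ℝ)⁻¹) • ∑ i : Fin k → Fin 4,
      ∑ r : Fin k → Fin 4, (g.density x₀ y / g.density x₀ z * ∏ a, (g.gram x₀ y)⁻¹ (i a) (r a)) •
        smulRightCLM (contract h (fun a => stdBasis (i a)) (g.volumeInChart x₀ z))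
          (inChart α x₀ y (fun a => stdBasis (r a)))) (extChartAt (𝓡 4) x₀).target := by
    refine ContDiffOn.const_smul _ (ContDiffOn.sum fun i _ => ContDiffOn.sum fun r _ => ?_)
    refine ContDiffOn.smul (((g.contDiffOn_density x₀).div_const _).mul
      (contDiffOn_prod fun a _ => g.contDiffOn_gram_inv x₀ _ _)) ?_
    exact (ContinuousLinearMap.contDiff _).comp_contDiffOn (hα.contDiffOn_apply x₀ _)
  refine key.congr fun y hy => ?_
  ext v
  rw [g.inChart_star_apply h α x₀ hy, ContinuousAlternatingMap.smul_apply,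
    ContinuousAlternatingMap.sum_apply]
  congr 1
  refine Finset.sum_congr rfl fun i _ => ?_
  rw [ContinuousAlternatingMap.sum_apply, Finset.smul_sum]
  refine Finset.sum_congr rfl fun r _ => ?_
  rw [ContinuousAlternatingMap.smul_apply, smulRightCLM_apply, smul_smul, smul_smul,
    g.volumeInChart_eq x₀ hz]
  congr 1
  simp only [contract_apply, ContinuousAlternatingMap.smul_apply, smul_eq_mul]
  ring

end StarSmooth

section Euclidean

open MeasureTheory

variable {E : Type*} [NormedAddCommGroup E] [NormedSpace ℝ E] [FiniteDimensional ℝ E]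
  [MeasurableSpace E] [BorelSpace E] {μ : Measure E} [μ.IsAddHaarMeasure] {T K : Set E}

omit [NormedSpace ℝ E] [FiniteDimensional ℝ E] in
lemma integrableOn_of_continuousOn_of_compact {h : E → ℝ} (hT : IsOpen T) (hK : IsCompact K)
    (hKT : K ⊆ T) (hh : ContinuousOn h T) (h0 : ∀ y ∈ T, y ∉ K → h y = 0) : IntegrableOn h T μ :=
  ((hh.mono hKT).integrableOn_compact hK).of_forall_sdiff_eq_zero hT.measurableSet
    fun y hy => h0 y hy.1 hy.2

lemma integral_fderiv_eq_zero_of_hasCompactSupport {u : E → ℝ} (hu : ContDiff ℝ 1 u)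
    (hc : HasCompactSupport u) (v : E) : ∫ y, fderiv ℝ u y v ∂μ = 0 := by
  have hi : Integrable (fun y => fderiv ℝ u y v) μ :=
    ((hu.continuous_fderiv (by simp)).clm_apply continuous_const).integrable_of_hasCompactSupport
      (hc.fderiv_apply ℝ v)
  have := integral_mul_fderiv_eq_neg_fderiv_mul_of_integrable (μ := μ) (f := fun _ : E => (1 : ℝ))
    (g := u) (v := v) (by simp) (by simpa using hi)
    (by simpa using hu.continuous.integrable_of_hasCompactSupport hc)
    (fun x _ => differentiableAt_const _) (fun x _ => hu.differentiable (by simp) x)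
  simpa using this

/-- The integral of a derivative of a function supported in a compact subset of `T` vanishes, even
when it is weighted by a locally constant function on `T`. -/
lemma setIntegral_mul_fderiv_eq_zero {u s : E → ℝ} (hT : IsOpen T) (hK : IsCompact K)
    (hKT : K ⊆ T) (hu : ContDiffOn ℝ ∞ u T) (h0 : ∀ y ∈ T, y ∉ K → u y = 0)
    (hs : ∀ y ∈ T, ∀ᶠ z in nhds y, s z = s y) (v : E) :
    IntegrableOn (fun y => s y * fderiv ℝ u y v) T μ ∧ ∫ y in T, s y * fderiv ℝ u y v ∂μ = 0 := by
  set U : E → ℝ := T.indicator fun y => s y * u y with hU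
  have hloc : ∀ y ∈ T, U =ᶠ[nhds y] fun z => s y * u z := by
    intro y hy
    filter_upwards [hs y hy, hT.mem_nhds hy] with z hz hzT
    rw [hU, Set.indicator_of_mem hzT, hz]
  have hU0 : ∀ y, y ∉ K → U y = 0 := by
    intro y hy
    by_cases hyT : y ∈ T
    · rw [hU, Set.indicator_of_mem hyT, h0 y hyT hy, mul_zero]
    · exact Set.indicator_of_notMem hyT _
  have hloc' : ∀ y, y ∉ T → U =ᶠ[nhds y] fun _ => 0 := by
    intro y hy
    filter_upwards [hK.isClosed.isOpen_compl.mem_nhds (fun h => hy (hKT h))] with z hz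
    exact hU0 z hz
  have hcd : ContDiff ℝ 1 U := by
    rw [contDiff_iff_contDiffAt]
    intro y
    by_cases hy : y ∈ T
    · refine ContDiffAt.congr_of_eventuallyEq ?_ (hloc y hy)
      exact contDiffAt_const.mul ((hu.contDiffAt (hT.mem_nhds hy)).of_le
        (WithTop.coe_le_coe.2 le_top))
    · exact contDiffAt_const.congr_of_eventuallyEq (hloc' y hy)
  have hcs : HasCompactSupport U := HasCompactSupport.intro hK fun y hy => hU0 y hy
  have hfd : (fun y => fderiv ℝ U y v) = T.indicator fun y => s y * fderiv ℝ u y v := by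
    funext y
    by_cases hy : y ∈ T
    · rw [(hloc y hy).fderiv_eq, Set.indicator_of_mem hy, fderiv_const_mul
        ((hu.contDiffAt (hT.mem_nhds hy)).differentiableAt (by simp))]
      rfl
    · rw [(hloc' y hy).fderiv_eq, Set.indicator_of_notMem hy]
      simp
  constructor
  · rw [← integrable_indicator_iff hT.measurableSet, ← hfd]
    exact ((hcd.continuous_fderiv (by simp)).clm_apply
      continuous_const).integrable_of_hasCompactSupport (hcs.fderiv_apply ℝ v)
  · rw [← integral_indicator hT.measurableSet, ← hfd]
    exact integral_fderiv_eq_zero_of_hasCompactSupport hcd hcs v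

end Euclidean

section ChartIntegral

open MeasureTheory

variable {X : Type*} [TopologicalSpace X] [ChartedSpace E4 X] [IsManifold (𝓡 4) ∞ X]
variable {J : AlmostComplexStructure X} (g : HermitianMetric J)

/-- The integral of a function over the chart at `x₀`, with respect to the Riemannian density. -/
def HermitianMetric.chartIntegral (x₀ : X) (f : X → ℝ) : ℝ :=
  ∫ y in (extChartAt (𝓡 4) x₀).target, f ((extChartAt (𝓡 4) x₀).symm y) * |g.density x₀ y|

lemma HermitianMetric.density_transition (x₀ x₁ : X) {y : E4} (hy : y ∈ overlap x₀ x₁) :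
    g.density x₀ y = (fderiv ℝ (transition x₀ x₁) y).det * g.density x₁ (transition x₀ x₁ y) := by
  have h1 : (extChartAt (𝓡 4) x₁).symm (transition x₀ x₁ y) = (extChartAt (𝓡 4) x₀).symm y :=
    (extChartAt (𝓡 4) x₁).left_inv hy.2
  have h2 := (g.volumeInChart x₁ (transition x₀ x₁ y)).toAlternatingMap.eq_smul_basis_det stdBasis
  have h3 : g.density x₀ y = (g.volumeInChart x₁ (transition x₀ x₁ y)).toAlternatingMap
      (fderiv ℝ (transition x₀ x₁) y ∘ stdBasis) := by
    rw [HermitianMetric.density, chartDeriv_eq_comp x₀ x₁ hy, ← h1]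
    rfl
  rw [h3, h2, AlternatingMap.smul_apply]
  have h4 := stdBasis.det_comp (fderiv ℝ (transition x₀ x₁) y).toLinearMap stdBasis
  rw [stdBasis.det_self, mul_one] at h4
  rw [smul_eq_mul, mul_comm]
  exact congrArg₂ (· * ·) h4 rfl

omit [IsManifold (𝓡 4) ∞ X] in
lemma transition_transition (x₀ x₁ : X) {y : E4} (hy : y ∈ overlap x₀ x₁) :
    transition x₀ x₁ y ∈ overlap x₁ x₀ ∧ transition x₁ x₀ (transition x₀ x₁ y) = y := by
  have h1 : (extChartAt (𝓡 4) x₁).symm (transition x₀ x₁ y) = (extChartAt (𝓡 4) x₀).symm y :=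
    (extChartAt (𝓡 4) x₁).left_inv hy.2
  refine ⟨⟨(extChartAt (𝓡 4) x₁).map_source hy.2, ?_⟩, ?_⟩
  · rw [Set.mem_preimage, h1]
    exact (extChartAt (𝓡 4) x₀).map_target hy.1
  · rw [transition, Function.comp_apply, h1]
    exact (extChartAt (𝓡 4) x₀).right_inv hy.1

/-- Functions supported in two charts have the same integral in both. -/
lemma HermitianMetric.chartIntegral_eq (x₀ x₁ : X) {f : X → ℝ}
    (h₀ : ∀ x, x ∉ (extChartAt (𝓡 4) x₀).source → f x = 0)
    (h₁ : ∀ x, x ∉ (extChartAt (𝓡 4) x₁).source → f x = 0) :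
    g.chartIntegral x₀ f = g.chartIntegral x₁ f := by
  have hres : ∀ x₀ x₁ : X, (∀ x, x ∉ (extChartAt (𝓡 4) x₁).source → f x = 0) →
      g.chartIntegral x₀ f =
        ∫ y in overlap x₀ x₁, f ((extChartAt (𝓡 4) x₀).symm y) * |g.density x₀ y| := by
    intro x₀ x₁ h
    refine (setIntegral_eq_of_subset_of_forall_sdiff_eq_zero
      (isOpen_extChartAt_target x₀).measurableSet Set.inter_subset_left fun y hy => ?_)
    rw [h _ fun hh => hy.2 ⟨hy.1, hh⟩, zero_mul]
  rw [hres x₀ x₁ h₁, hres x₁ x₀ h₀]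
  have himg : overlap x₁ x₀ = transition x₀ x₁ '' overlap x₀ x₁ := by
    ext z
    constructor
    · intro hz
      exact ⟨_, (transition_transition x₁ x₀ hz).1, (transition_transition x₁ x₀ hz).2⟩
    · rintro ⟨y, hy, rfl⟩
      exact (transition_transition x₀ x₁ hy).1
  rw [himg, integral_image_eq_integral_abs_det_fderiv_smul volume
    (isOpen_overlap x₀ x₁).measurableSet (f' := fun y => fderiv ℝ (transition x₀ x₁) y)
    (fun y hy => (((contDiffOn_transition x₀ x₁).contDiffAt
      ((isOpen_overlap x₀ x₁).mem_nhds hy)).differentiableAt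
        (by simp)).hasFDerivAt.hasFDerivWithinAt)
    (fun y hy z hz hyz => by
      rw [← (transition_transition x₀ x₁ hy).2, ← (transition_transition x₀ x₁ hz).2, hyz])]
  refine setIntegral_congr_fun (isOpen_overlap x₀ x₁).measurableSet fun y hy => ?_
  have h1 : (extChartAt (𝓡 4) x₁).symm (transition x₀ x₁ y) = (extChartAt (𝓡 4) x₀).symm y :=
    (extChartAt (𝓡 4) x₁).left_inv hy.2
  simp only [h1, g.density_transition x₀ x₁ hy, abs_mul, smul_eq_mul]
  ring

end ChartIntegral

section Stokes

open MeasureTheory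

variable {X : Type*} [TopologicalSpace X] [ChartedSpace E4 X] [IsManifold (𝓡 4) ∞ X]
variable {J : AlmostComplexStructure X} (g : HermitianMetric J)

/-- The four-form `d(γ ∧ θ) = dγ ∧ θ + γ ∧ dθ` of a two-form `γ` and a one-form `θ`. -/
def wedgeDeriv (γ : Form X 2 ℝ) (θ : Form X 1 ℝ) (x : X) : E4 [⋀^Fin 4]→ₗ[ℝ] ℝ :=
  wedgeThreeOne (valueAt (extD γ) x) (valueAt θ x) + wedgeTwoTwo (valueAt γ x) (valueAt (extD θ) x)

/-- The function `f` with `d(γ ∧ θ) = f vol`. -/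
def HermitianMetric.wedgeDerivRatio (γ : Form X 2 ℝ) (θ : Form X 1 ℝ) (x : X) : ℝ :=
  wedgeDeriv γ θ x stdBasis / halfSquare (AlmostHermitian.valueAt g.fundamentalForm x) stdBasis

lemma HermitianMetric.wedgeDerivRatio_mul (γ : Form X 2 ℝ) (θ : Form X 1 ℝ) (x : X)
    (v : Fin 4 → E4) :
    g.wedgeDerivRatio γ θ x * halfSquare (AlmostHermitian.valueAt g.fundamentalForm x) v =
      wedgeDeriv γ θ x v := by
  have h0 := halfSquare_ne_zero (g.isHermitianPair x) (g.valueAt_fundamentalForm x) stdBasis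
  have h1 := congrArg (fun f => f v) ((wedgeDeriv γ θ x).eq_smul_basis_det stdBasis)
  have h2 := congrArg (fun f => f v)
    ((halfSquare (AlmostHermitian.valueAt g.fundamentalForm x)).toAlternatingMap.eq_smul_basis_det
      stdBasis)
  change halfSquare _ v = halfSquare _ _ * _ at h2
  change wedgeDeriv γ θ x v = wedgeDeriv γ θ x stdBasis * _ at h1
  rw [h1, h2, wedgeDerivRatio]
  field_simp

omit [IsManifold (𝓡 4) ∞ X] in
lemma inChart_vec_one (α : Form X 1 ℝ) (x₀ : X) (y u : E4) :
    inChart α x₀ y ![u] =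
      valueAt α ((extChartAt (𝓡 4) x₀).symm y) ![chartDeriv x₀ y u] := by
  rw [inChart_eq, ContinuousAlternatingMap.compContinuousLinearMap_apply]
  congr 1
  funext i
  fin_cases i
  rfl

omit [IsManifold (𝓡 4) ∞ X] in
lemma inChart_vec_two (α : Form X 2 ℝ) (x₀ : X) (y u v : E4) :
    inChart α x₀ y ![u, v] = valueAt α ((extChartAt (𝓡 4) x₀).symm y)
      ![chartDeriv x₀ y u, chartDeriv x₀ y v] := by
  rw [inChart_eq, ContinuousAlternatingMap.compContinuousLinearMap_apply]
  congr 1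
  funext i
  fin_cases i <;> rfl

omit [IsManifold (𝓡 4) ∞ X] in
lemma inChart_vec_three (α : Form X 3 ℝ) (x₀ : X) (y u v w : E4) :
    inChart α x₀ y ![u, v, w] = valueAt α ((extChartAt (𝓡 4) x₀).symm y)
      ![chartDeriv x₀ y u, chartDeriv x₀ y v, chartDeriv x₀ y w] := by
  rw [inChart_eq, ContinuousAlternatingMap.compContinuousLinearMap_apply]
  congr 1
  funext i
  fin_cases i <;> rfl

lemma HermitianMetric.wedgeDerivRatio_mul_density (γ : Form X 2 ℝ) (θ : Form X 1 ℝ) (x₀ : X)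
    (y : E4) : g.wedgeDerivRatio γ θ ((extChartAt (𝓡 4) x₀).symm y) * g.density x₀ y =
      wedgeThreeOne (inChart (extD γ) x₀ y) (inChart θ x₀ y) stdBasis +
        wedgeTwoTwo (inChart γ x₀ y) (inChart (extD θ) x₀ y) stdBasis := by
  rw [HermitianMetric.density, g.wedgeDerivRatio_mul, wedgeDeriv, AlternatingMap.add_apply]
  simp only [wedgeThreeOne_apply, wedgeTwoTwo_apply, inChart_vec_one, inChart_vec_two,
    inChart_vec_three]

lemma HermitianMetric.continuousOn_wedgeDerivRatio {γ : Form X 2 ℝ} {θ : Form X 1 ℝ}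
    (hγ : IsSmooth γ) (hθ : IsSmooth θ) (x₀ : X) :
    ContinuousOn (fun y => g.wedgeDerivRatio γ θ ((extChartAt (𝓡 4) x₀).symm y))
      (extChartAt (𝓡 4) x₀).target := by
  have h : ContinuousOn (fun y => (wedgeThreeOne (inChart (extD γ) x₀ y) (inChart θ x₀ y) stdBasis +
        wedgeTwoTwo (inChart γ x₀ y) (inChart (extD θ) x₀ y) stdBasis) / g.density x₀ y)
      (extChartAt (𝓡 4) x₀).target := by
    have h1 := fun v => (hγ.contDiffOn_apply x₀ v).continuousOn
    have h2 := fun v => (hθ.contDiffOn_apply x₀ v).continuousOn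
    have h3 := fun v => (hγ.extD.contDiffOn_apply x₀ v).continuousOn
    have h4 := fun v => (hθ.extD.contDiffOn_apply x₀ v).continuousOn
    refine ContinuousOn.div ?_ (g.contDiffOn_density x₀).continuousOn
      fun y hy => g.density_ne_zero x₀ hy
    simp only [wedgeThreeOne_apply, wedgeTwoTwo_apply]
    have a := fun v w => (h3 v).mul (h2 w)
    have b := fun v w => (h1 v).mul (h4 w)
    exact ((((a _ _).sub (a _ _)).add (a _ _)).sub (a _ _)).add
      ((((((b _ _).sub (b _ _)).add (b _ _)).add (b _ _)).sub (b _ _)).add (b _ _))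
  refine h.congr fun y hy => ?_
  dsimp only
  rw [← g.wedgeDerivRatio_mul_density, mul_div_cancel_right₀ _ (g.density_ne_zero x₀ hy)]

lemma extDeriv_vec_three {E : Type*} [NormedAddCommGroup E] [NormedSpace ℝ E]
    {β : E → E [⋀^Fin 2]→L[ℝ] ℝ} {y : E} (h : DifferentiableAt ℝ β y) (u v w : E) :
    extDeriv β y ![u, v, w] = fderiv ℝ (fun z => β z ![v, w]) y u -
      fderiv ℝ (fun z => β z ![u, w]) y v + fderiv ℝ (fun z => β z ![u, v]) y w := by
  have e0 : (0 : Fin 3).removeNth ![u, v, w] = ![v, w] := by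
    funext i; fin_cases i <;> rfl
  have e1 : (1 : Fin 3).removeNth ![u, v, w] = ![u, w] := by
    funext i; fin_cases i <;> rfl
  have e2 : (2 : Fin 3).removeNth ![u, v, w] = ![u, v] := by
    funext i; fin_cases i <;> rfl
  rw [extDeriv_apply h, Fin.sum_univ_three, e0, e1, e2]
  simp [sub_eq_add_neg]

lemma extDeriv_vec_two {E : Type*} [NormedAddCommGroup E] [NormedSpace ℝ E]
    {β : E → E [⋀^Fin 1]→L[ℝ] ℝ} {y : E} (h : DifferentiableAt ℝ β y) (u v : E) :
    extDeriv β y ![u, v] = fderiv ℝ (fun z => β z ![v]) y u - fderiv ℝ (fun z => β z ![u]) y v := by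
  have e0 : (0 : Fin 2).removeNth ![u, v] = ![v] := by
    funext i; fin_cases i; rfl
  have e1 : (1 : Fin 2).removeNth ![u, v] = ![u] := by
    funext i; fin_cases i; rfl
  rw [extDeriv_apply h, Fin.sum_univ_two, e0, e1]
  simp [sub_eq_add_neg]

/-- The components of the vector field whose divergence is the exterior derivative of `γ ∧ θ`. -/
def wedgeComponent (γ : Form X 2 ℝ) (θ : Form X 1 ℝ) (x₀ : X) (i j k : Fin 4) (y : E4) : ℝ :=
  inChart γ x₀ y ![stdBasis i, stdBasis j] * inChart θ x₀ y ![stdBasis k] -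
    inChart γ x₀ y ![stdBasis i, stdBasis k] * inChart θ x₀ y ![stdBasis j] +
    inChart γ x₀ y ![stdBasis j, stdBasis k] * inChart θ x₀ y ![stdBasis i]

omit [IsManifold (𝓡 4) ∞ X] in
lemma contDiffOn_wedgeComponent {γ : Form X 2 ℝ} {θ : Form X 1 ℝ} (hγ : IsSmooth γ)
    (hθ : IsSmooth θ) (x₀ : X) (i j k : Fin 4) :
    ContDiffOn ℝ ∞ (wedgeComponent γ θ x₀ i j k) (extChartAt (𝓡 4) x₀).target := by
  have a := fun v w => (hγ.contDiffOn_apply x₀ v).mul (hθ.contDiffOn_apply x₀ w)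
  exact ((a _ _).sub (a _ _)).add (a _ _)

omit [IsManifold (𝓡 4) ∞ X] in
lemma fderiv_wedgeComponent {γ : Form X 2 ℝ} {θ : Form X 1 ℝ} (hγ : IsSmooth γ)
    (hθ : IsSmooth θ) (x₀ : X) (i j k : Fin 4) {y : E4} (hy : y ∈ (extChartAt (𝓡 4) x₀).target)
    (v : E4) : fderiv ℝ (wedgeComponent γ θ x₀ i j k) y v =
      (inChart γ x₀ y ![stdBasis i, stdBasis j] * fderiv ℝ (inChart θ x₀ · ![stdBasis k]) y v +
        fderiv ℝ (inChart γ x₀ · ![stdBasis i, stdBasis j]) y v * inChart θ x₀ y ![stdBasis k]) -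
      (inChart γ x₀ y ![stdBasis i, stdBasis k] * fderiv ℝ (inChart θ x₀ · ![stdBasis j]) y v +
        fderiv ℝ (inChart γ x₀ · ![stdBasis i, stdBasis k]) y v * inChart θ x₀ y ![stdBasis j]) +
      (inChart γ x₀ y ![stdBasis j, stdBasis k] * fderiv ℝ (inChart θ x₀ · ![stdBasis i]) y v +
        fderiv ℝ (inChart γ x₀ · ![stdBasis j, stdBasis k]) y v *
          inChart θ x₀ y ![stdBasis i]) := by
  have hT := (isOpen_extChartAt_target (I := 𝓡 4) x₀).mem_nhds hy
  have h1 := fun v => (((hγ.contDiffOn_apply x₀ v).contDiffAt hT).differentiableAt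
    (by simp)).hasFDerivAt
  have h2 := fun v => (((hθ.contDiffOn_apply x₀ v).contDiffAt hT).differentiableAt
    (by simp)).hasFDerivAt
  have a := fun v w => (h1 v).mul (h2 w)
  have := (((a ![stdBasis i, stdBasis j] ![stdBasis k]).sub
    (a ![stdBasis i, stdBasis k] ![stdBasis j])).add
    (a ![stdBasis j, stdBasis k] ![stdBasis i])).fderiv
  refine (congrArg (fun L : E4 →L[ℝ] ℝ => L v) this).trans ?_
  simp only [add_apply, sub_apply, smul_apply, smul_eq_mul]
  ring

/-- In a chart, the exterior derivative of `γ ∧ θ` is a divergence. -/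
lemma HermitianMetric.wedgeDerivRatio_mul_density_eq {γ : Form X 2 ℝ} {θ : Form X 1 ℝ}
    (hγ : IsSmooth γ) (hθ : IsSmooth θ) (x₀ : X) {y : E4}
    (hy : y ∈ (extChartAt (𝓡 4) x₀).target) :
    g.wedgeDerivRatio γ θ ((extChartAt (𝓡 4) x₀).symm y) * g.density x₀ y =
      fderiv ℝ (wedgeComponent γ θ x₀ 1 2 3) y (stdBasis 0) -
      fderiv ℝ (wedgeComponent γ θ x₀ 0 2 3) y (stdBasis 1) +
      fderiv ℝ (wedgeComponent γ θ x₀ 0 1 3) y (stdBasis 2) -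
      fderiv ℝ (wedgeComponent γ θ x₀ 0 1 2) y (stdBasis 3) := by
  rw [g.wedgeDerivRatio_mul_density, wedgeThreeOne_apply, wedgeTwoTwo_apply, inChart_extD hγ x₀ hy,
    inChart_extD hθ x₀ hy]
  simp only [extDeriv_vec_three (hγ.differentiableAt_inChart x₀ hy),
    extDeriv_vec_two (hθ.differentiableAt_inChart x₀ hy), fderiv_wedgeComponent hγ hθ x₀ _ _ _ hy]
  ring

/-- Stokes' theorem for the form `γ ∧ θ` with support in a chart. -/
lemma HermitianMetric.chartIntegral_wedgeDerivRatio {γ : Form X 2 ℝ} {θ : Form X 1 ℝ}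
    (hγ : IsSmooth γ) (hθ : IsSmooth θ) (x₀ : X) {C : Set X} (hC : IsCompact C)
    (hCs : C ⊆ (extChartAt (𝓡 4) x₀).source) (h0 : ∀ x, x ∉ C → γ x = 0) :
    g.chartIntegral x₀ (g.wedgeDerivRatio γ θ) = 0 := by
  set T := (extChartAt (𝓡 4) x₀).target
  have hT : IsOpen T := isOpen_extChartAt_target x₀
  set K := extChartAt (𝓡 4) x₀ '' C
  have hK : IsCompact K := hC.image_of_continuousOn ((continuousOn_extChartAt x₀).mono hCs)
  have hKT : K ⊆ T := by
    rintro _ ⟨x, hx, rfl⟩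
    exact (extChartAt (𝓡 4) x₀).map_source (hCs hx)
  have hγ0 : ∀ y ∈ T, y ∉ K → inChart γ x₀ y = 0 := by
    intro y hy hyK
    have : AlmostHermitian.valueAt γ ((extChartAt (𝓡 4) x₀).symm y) = 0 :=
      h0 _ fun h => hyK ⟨_, h, (extChartAt (𝓡 4) x₀).right_inv hy⟩
    rw [inChart_eq, this]
    rfl
  set s : E4 → ℝ := fun y => |g.density x₀ y| / g.density x₀ y with hs
  have hsl : ∀ y ∈ T, ∀ᶠ z in nhds y, s z = s y := by
    intro y hy
    have hc : ContinuousAt (g.density x₀) y :=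
      (g.contDiffOn_density x₀).continuousOn.continuousAt (hT.mem_nhds hy)
    rcases lt_or_gt_of_ne (g.density_ne_zero x₀ hy) with h | h
    · filter_upwards [hc.eventually_lt_const h] with z hz
      rw [hs]
      simp only [abs_of_neg h, abs_of_neg hz, neg_div, div_self h.ne, div_self hz.ne]
    · filter_upwards [hc.eventually_const_lt h] with z hz
      rw [hs]
      simp only [abs_of_pos h, abs_of_pos hz, div_self h.ne', div_self hz.ne']
  have key := fun i j k v => setIntegral_mul_fderiv_eq_zero (μ := (volume : Measure E4)) hT hK hKT
    (contDiffOn_wedgeComponent hγ hθ x₀ i j k)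
    (fun y hy hyK => by simp [wedgeComponent, hγ0 y hy hyK]) hsl v
  have heq : ∀ y ∈ T, g.wedgeDerivRatio γ θ ((extChartAt (𝓡 4) x₀).symm y) * |g.density x₀ y| =
      s y * fderiv ℝ (wedgeComponent γ θ x₀ 1 2 3) y (stdBasis 0) -
      s y * fderiv ℝ (wedgeComponent γ θ x₀ 0 2 3) y (stdBasis 1) +
      s y * fderiv ℝ (wedgeComponent γ θ x₀ 0 1 3) y (stdBasis 2) -
      s y * fderiv ℝ (wedgeComponent γ θ x₀ 0 1 2) y (stdBasis 3) := by
    intro y hy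
    have h := g.wedgeDerivRatio_mul_density_eq hγ hθ x₀ hy
    have hd := g.density_ne_zero x₀ hy
    have : |g.density x₀ y| = s y * g.density x₀ y := (div_mul_cancel₀ _ hd).symm
    rw [this]
    linear_combination s y * h
  have hcomb : ∀ {a b c d : E4 → ℝ}, IntegrableOn a T volume ∧ ∫ y in T, a y = 0 →
      IntegrableOn b T volume ∧ ∫ y in T, b y = 0 → IntegrableOn c T volume ∧ ∫ y in T, c y = 0 →
      IntegrableOn d T volume ∧ ∫ y in T, d y = 0 → ∫ y in T, a y - b y + c y - d y = 0 := by
    intro a b c d ha hb hc hd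
    have h1 := integral_sub ((ha.1.sub hb.1).add hc.1) hd.1
    have h2 := integral_add (ha.1.sub hb.1) hc.1
    have h3 := integral_sub ha.1 hb.1
    simp only [Pi.add_apply, Pi.sub_apply] at h1 h2 h3
    rw [h1, h2, h3, ha.2, hb.2, hc.2, hd.2]
    simp
  rw [HermitianMetric.chartIntegral, setIntegral_congr_fun hT.measurableSet heq]
  exact hcomb (key _ _ _ _) (key _ _ _ _) (key _ _ _ _) (key _ _ _ _)

end Stokes

section GlobalStokes

open MeasureTheory

variable {X : Type*} [TopologicalSpace X] [ChartedSpace E4 X] [IsManifold (𝓡 4) ∞ X]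
variable {F : Type*} [NormedAddCommGroup F] [NormedSpace ℝ F] {k : ℕ}
variable {J : AlmostComplexStructure X} (g : HermitianMetric J)

/-- The product of a function and a form. -/
def mulForm (f : X → ℝ) (α : Form X k F) : Form X k F := fun x => f x • α x

lemma contDiffOn_comp_extChartAt_symm {f : X → ℝ} (hf : ContMDiff (𝓡 4) 𝓘(ℝ) ∞ f) (x₀ : X) :
    ContDiffOn ℝ ∞ (fun y => f ((extChartAt (𝓡 4) x₀).symm y)) (extChartAt (𝓡 4) x₀).target := by
  rw [← contMDiffOn_iff_contDiffOn]
  exact hf.comp_contMDiffOn (contMDiffOn_extChartAt_symm (I := 𝓡 4) (n := ∞) x₀)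

lemma IsSmooth.mulForm {f : X → ℝ} (hf : ContMDiff (𝓡 4) 𝓘(ℝ) ∞ f) {α : Form X k F}
    (hα : IsSmooth α) : IsSmooth (mulForm f α) := fun x₀ =>
  (contDiffOn_comp_extChartAt_symm hf x₀).smul (hα x₀)

/-- The exterior derivative vanishes where the form vanishes locally. -/
lemma extD_eq_zero_of_eventually {α : Form X k F} {x : X} (h : ∀ᶠ z in nhds x, α z = 0) :
    valueAt (extD α) x = 0 := by
  have hc : ContinuousAt (extChartAt (𝓡 4) x).symm (extChartAt (𝓡 4) x x) :=
    continuousAt_extChartAt_symm x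
  have h' : Filter.Tendsto (extChartAt (𝓡 4) x).symm (nhds (extChartAt (𝓡 4) x x)) (nhds x) := by
    have := hc.tendsto
    rwa [extChartAt_to_inv] at this
  have h0 : inChart α x =ᶠ[nhds (extChartAt (𝓡 4) x x)] inChart 0 x := by
    filter_upwards [h'.eventually h] with y hy
    have : valueAt α ((extChartAt (𝓡 4) x).symm y) = 0 := hy
    rw [inChart_eq, this]
    rfl
  have h1 := congrFun (extD_zero (X := X) (F := F) (k := k)) x
  rw [valueAt_extD, h0.extDeriv_eq, ← valueAt_extD]
  exact h1

lemma wedgeThreeOne_add_left (τ τ' : E4 [⋀^Fin 3]→L[ℝ] ℝ) (θ : E4 [⋀^Fin 1]→L[ℝ] ℝ) :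
    wedgeThreeOne (τ + τ') θ = wedgeThreeOne τ θ + wedgeThreeOne τ' θ := by
  ext v
  simp only [AlternatingMap.add_apply, wedgeThreeOne_apply, ContinuousAlternatingMap.add_apply]
  ring

lemma wedgeTwoTwo_add_left (α α' β : E4 [⋀^Fin 2]→L[ℝ] ℝ) :
    wedgeTwoTwo (α + α') β = wedgeTwoTwo α β + wedgeTwoTwo α' β := by
  ext v
  simp only [AlternatingMap.add_apply, wedgeTwoTwo_apply, ContinuousAlternatingMap.add_apply]
  ring

lemma HermitianMetric.wedgeDerivRatio_add {γ γ' : Form X 2 ℝ} (θ : Form X 1 ℝ) (hγ : IsSmooth γ)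
    (hγ' : IsSmooth γ') (x : X) :
    g.wedgeDerivRatio (γ + γ') θ x = g.wedgeDerivRatio γ θ x + g.wedgeDerivRatio γ' θ x := by
  have h1 : AlmostHermitian.valueAt (extD (γ + γ')) x =
      AlmostHermitian.valueAt (extD γ) x + AlmostHermitian.valueAt (extD γ') x := by
    rw [extD_add hγ hγ']
    rfl
  have h2 : AlmostHermitian.valueAt (γ + γ') x =
      AlmostHermitian.valueAt γ x + AlmostHermitian.valueAt γ' x := rfl
  have h3 : wedgeDeriv (γ + γ') θ x = wedgeDeriv γ θ x + wedgeDeriv γ' θ x := by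
    rw [wedgeDeriv, h1, h2, wedgeThreeOne_add_left, wedgeTwoTwo_add_left, wedgeDeriv, wedgeDeriv]
    abel
  rw [wedgeDerivRatio, h3, AlternatingMap.add_apply, add_div]
  rfl

lemma HermitianMetric.wedgeDerivRatio_eq_zero {γ : Form X 2 ℝ} (θ : Form X 1 ℝ) {x : X}
    (h : ∀ᶠ z in nhds x, γ z = 0) : g.wedgeDerivRatio γ θ x = 0 := by
  have h0 : AlmostHermitian.valueAt γ x = 0 := h.self_of_nhds
  rw [wedgeDerivRatio, wedgeDeriv, extD_eq_zero_of_eventually h, h0, AlternatingMap.add_apply,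
    wedgeThreeOne_apply, wedgeTwoTwo_apply]
  simp

lemma HermitianMetric.wedgeDerivRatio_sum {ι : Type*} (s : Finset ι) {γ : ι → Form X 2 ℝ}
    (θ : Form X 1 ℝ) (hγ : ∀ i, IsSmooth (γ i)) (x : X) :
    g.wedgeDerivRatio (∑ i ∈ s, γ i) θ x = ∑ i ∈ s, g.wedgeDerivRatio (γ i) θ x := by
  classical
  suffices h : IsSmooth (∑ i ∈ s, γ i) ∧
      g.wedgeDerivRatio (∑ i ∈ s, γ i) θ x = ∑ i ∈ s, g.wedgeDerivRatio (γ i) θ x from h.2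
  induction s using Finset.induction_on with
  | empty =>
    refine ⟨isSmooth_zero, ?_⟩
    rw [Finset.sum_empty, Finset.sum_empty]
    exact g.wedgeDerivRatio_eq_zero θ (Filter.Eventually.of_forall fun z => rfl)
  | insert i s hi ih =>
    rw [Finset.sum_insert hi, Finset.sum_insert hi]
    exact ⟨(hγ i).add ih.1, by rw [g.wedgeDerivRatio_add θ (hγ i) ih.1, ih.2]⟩

/-- The function `f` with `d(γ ∧ θ) = f vol` vanishes on a compact manifold if it is nonnegative. -/
theorem HermitianMetric.wedgeDerivRatio_eq_zero_of_nonneg [T2Space X] [CompactSpace X]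
    {γ : Form X 2 ℝ} {θ : Form X 1 ℝ} (hγ : IsSmooth γ) (hθ : IsSmooth θ)
    (hnn : ∀ x, 0 ≤ g.wedgeDerivRatio γ θ x) (x : X) : g.wedgeDerivRatio γ θ x = 0 := by
  obtain ⟨ρ, hρ⟩ := SmoothPartitionOfUnity.exists_isSubordinate_chartAt_source (𝓡 4) X
  have hfin := ρ.locallyFinite.finite_nonempty_of_compact
  set s : Finset X := hfin.toFinset with hs
  have hsum : ∀ x, ∑ i ∈ s, ρ i x = 1 := by
    intro x
    rw [← ρ.sum_eq_one (Set.mem_univ x), finsum_eq_sum_of_support_subset]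
    intro i hi
    rw [hs, Set.Finite.coe_toFinset]
    exact ⟨x, hi⟩
  have hsub : ∀ i, tsupport (ρ i) ⊆ (extChartAt (𝓡 4) i).source := fun i => by
    rw [extChartAt_source]; exact hρ i
  have hzero : ∀ i x, x ∉ (extChartAt (𝓡 4) i).source → ρ i x = 0 := fun i x hx =>
    image_eq_zero_of_notMem_tsupport fun h => hx (hsub i h)
  set Γ : X → Form X 2 ℝ := fun j => mulForm (ρ j) γ with hΓ
  have hΓs : ∀ j, IsSmooth (Γ j) := fun j => hγ.mulForm (ρ j).contMDiff
  have hΓ0 : ∀ j x, x ∉ tsupport (ρ j) → Γ j x = 0 := by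
    intro j x hx
    change ρ j x • γ x = 0
    rw [image_eq_zero_of_notMem_tsupport hx, zero_smul]
  have hΓsum : ∑ j ∈ s, Γ j = γ := by
    funext x
    rw [Finset.sum_apply]
    change ∑ j ∈ s, ρ j x • γ x = γ x
    rw [← Finset.sum_smul, hsum, one_smul]
  set f := g.wedgeDerivRatio γ θ with hf
  set φ : X → X → ℝ := fun j => g.wedgeDerivRatio (Γ j) θ with hφ
  have hφ0 : ∀ j x, x ∉ tsupport (ρ j) → φ j x = 0 := by
    intro j x hx
    apply g.wedgeDerivRatio_eq_zero
    filter_upwards [(isClosed_tsupport (ρ j)).isOpen_compl.mem_nhds hx] with z hz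
    exact hΓ0 j z hz
  have hfφ : ∀ x, f x = ∑ j ∈ s, φ j x := by
    intro x
    rw [hf, ← g.wedgeDerivRatio_sum s θ hΓs, hΓsum]
  have hint : ∀ (i : X) (u : X → ℝ), ContinuousOn (fun y => u ((extChartAt (𝓡 4) i).symm y))
      (extChartAt (𝓡 4) i).target → (∀ x, x ∉ tsupport (ρ i) → u x = 0) →
      IntegrableOn (fun y => u ((extChartAt (𝓡 4) i).symm y) * |g.density i y|)
        (extChartAt (𝓡 4) i).target volume := by
    intro i u hu hu0
    refine integrableOn_of_continuousOn_of_compact (isOpen_extChartAt_target i)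
      (K := extChartAt (𝓡 4) i '' tsupport (ρ i))
      ((isClosed_tsupport (ρ i)).isCompact.image_of_continuousOn
        ((continuousOn_extChartAt i).mono (hsub i))) ?_
      (hu.mul (g.contDiffOn_density i).continuousOn.abs) ?_
    · rintro _ ⟨x, hx, rfl⟩
      exact (extChartAt (𝓡 4) i).map_source (hsub i hx)
    · intro y hy hyK
      rw [hu0 _ fun h => hyK ⟨_, h, (extChartAt (𝓡 4) i).right_inv hy⟩, zero_mul]
  have hρc : ∀ i j, ContinuousOn (fun y => ρ j ((extChartAt (𝓡 4) i).symm y))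
      (extChartAt (𝓡 4) i).target := fun i j =>
    (ρ j).contMDiff.continuous.comp_continuousOn (continuousOn_extChartAt_symm i)
  have hφc : ∀ i j, ContinuousOn (fun y => φ j ((extChartAt (𝓡 4) i).symm y))
      (extChartAt (𝓡 4) i).target := fun i j => g.continuousOn_wedgeDerivRatio (hΓs j) hθ i
  have hfc : ∀ i, ContinuousOn (fun y => f ((extChartAt (𝓡 4) i).symm y))
      (extChartAt (𝓡 4) i).target := fun i => g.continuousOn_wedgeDerivRatio hγ hθ i
  have h1 : ∀ i, g.chartIntegral i (fun x => ρ i x * f x) =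
      ∑ j ∈ s, g.chartIntegral i (fun x => ρ i x * φ j x) := by
    intro i
    simp only [HermitianMetric.chartIntegral]
    rw [← integral_finsetSum]
    · refine integral_congr_ae (Filter.Eventually.of_forall fun y => ?_)
      simp only [hfφ, Finset.mul_sum, Finset.sum_mul]
    · intro j _
      exact hint i (fun x => ρ i x * φ j x) ((hρc i i).mul (hφc i j)) fun x hx => by
        rw [image_eq_zero_of_notMem_tsupport hx, zero_mul]
  have h2 : ∀ j, g.chartIntegral j (φ j) =
      ∑ i ∈ s, g.chartIntegral j (fun x => ρ i x * φ j x) := by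
    intro j
    simp only [HermitianMetric.chartIntegral]
    rw [← integral_finsetSum]
    · refine integral_congr_ae (Filter.Eventually.of_forall fun y => ?_)
      simp only [← Finset.sum_mul, hsum, one_mul]
    · intro i _
      exact hint j (fun x => ρ i x * φ j x) ((hρc j i).mul (hφc j j)) fun x hx => by
        rw [hφ0 j x hx, mul_zero]
  have h3 : ∀ i j, g.chartIntegral i (fun x => ρ i x * φ j x) =
      g.chartIntegral j (fun x => ρ i x * φ j x) := by
    intro i j
    apply g.chartIntegral_eq
    · intro x hx
      rw [hzero i x hx, zero_mul]
    · intro x hx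
      rw [hφ0 j x fun h => hx (hsub j h), mul_zero]
  have h4 : ∀ j, g.chartIntegral j (φ j) = 0 := fun j =>
    g.chartIntegral_wedgeDerivRatio (hΓs j) hθ j (isClosed_tsupport (ρ j)).isCompact (hsub j) (hΓ0 j)
  have h5 : ∑ i ∈ s, g.chartIntegral i (fun x => ρ i x * f x) = 0 := by
    simp only [h1]
    rw [Finset.sum_comm]
    simp only [h3, ← h2, h4, Finset.sum_const_zero]
  have hnn' : ∀ i y, 0 ≤ (ρ i ((extChartAt (𝓡 4) i).symm y) * f ((extChartAt (𝓡 4) i).symm y)) *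
      |g.density i y| := fun i y =>
    mul_nonneg (mul_nonneg (ρ.nonneg i _) (hnn _)) (abs_nonneg _)
  have h6 : ∀ i ∈ s, g.chartIntegral i (fun x => ρ i x * f x) = 0 := by
    rwa [Finset.sum_eq_zero_iff_of_nonneg] at h5
    intro i _
    exact integral_nonneg (hnn' i)
  have h7 : ∀ i ∈ s, ρ i x * f x = 0 := by
    intro i hi
    by_cases hx : x ∈ (extChartAt (𝓡 4) i).source
    swap
    · rw [hzero i x hx, zero_mul]
    have hc : ContinuousOn (fun y => ρ i ((extChartAt (𝓡 4) i).symm y) *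
        f ((extChartAt (𝓡 4) i).symm y)) (extChartAt (𝓡 4) i).target := (hρc i i).mul (hfc i)
    have hi0 := h6 i hi
    rw [HermitianMetric.chartIntegral, setIntegral_eq_zero_iff_of_nonneg_ae
      (Filter.Eventually.of_forall (hnn' i)) (hint i (fun x => ρ i x * f x) hc fun x hx => by
        rw [image_eq_zero_of_notMem_tsupport hx, zero_mul])] at hi0
    have he := Measure.eqOn_open_of_ae_eq hi0 (isOpen_extChartAt_target i)
      (hc.mul (g.contDiffOn_density i).continuousOn.abs) continuousOn_const
    have := he ((extChartAt (𝓡 4) i).map_source hx)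
    simp only [(extChartAt (𝓡 4) i).left_inv hx, Pi.zero_apply, mul_eq_zero, abs_eq_zero] at this
    rcases this with h | h
    · exact mul_eq_zero.2 h
    · exact absurd h (g.density_ne_zero i ((extChartAt (𝓡 4) i).map_source hx))
  calc f x = ∑ i ∈ s, ρ i x * f x := by rw [← Finset.sum_mul, hsum, one_mul]
    _ = 0 := Finset.sum_eq_zero h7

end GlobalStokes

section StarLinear

variable {V : Type*} [AddCommGroup V] [Module ℝ V] [TopologicalSpace V]
variable {F : Type*} [NormedAddCommGroup F] [NormedSpace ℝ F]
variable {G : Type*} [NormedAddCommGroup G] [NormedSpace ℝ G] {k l : ℕ}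

lemma starAt_neg (h : k + l = 4) (m : V →L[ℝ] V →L[ℝ] ℝ) (vol : V [⋀^Fin 4]→L[ℝ] ℝ)
    (b : Fin 4 → V) (α : V [⋀^Fin k]→L[ℝ] F) : starAt h m vol b (-α) = -starAt h m vol b α := by
  ext v
  simp only [starAt_apply, ContinuousAlternatingMap.neg_apply, smul_neg, Finset.sum_neg_distrib]

lemma starAt_zero (h : k + l = 4) (m : V →L[ℝ] V →L[ℝ] ℝ) (vol : V [⋀^Fin 4]→L[ℝ] ℝ)
    (b : Fin 4 → V) : starAt h m vol b (0 : V [⋀^Fin k]→L[ℝ] F) = 0 := by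
  ext v
  simp [starAt_apply]

lemma starAt_compContinuousAlternatingMap (h : k + l = 4) (m : V →L[ℝ] V →L[ℝ] ℝ)
    (vol : V [⋀^Fin 4]→L[ℝ] ℝ) (b : Fin 4 → V) (L : F →L[ℝ] G) (α : V [⋀^Fin k]→L[ℝ] F) :
    starAt h m vol b (L.compContinuousAlternatingMap α) =
      L.compContinuousAlternatingMap (starAt h m vol b α) := by
  ext v
  rw [L.compContinuousAlternatingMap_coe, Function.comp_apply, starAt_apply, starAt_apply, map_smul,
    map_sum]
  simp only [map_smul]
  rfl

end StarLinear

section Harmonic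

variable {X : Type*} [TopologicalSpace X] [ChartedSpace E4 X] [IsManifold (𝓡 4) ∞ X]
variable {F : Type*} [NormedAddCommGroup F] [NormedSpace ℝ F]
variable {G : Type*} [NormedAddCommGroup G] [NormedSpace ℝ G] {k l : ℕ}
variable {J : AlmostComplexStructure X} (g : HermitianMetric J)

lemma HermitianMetric.star_neg (h : k + l = 4) (α : Form X k F) :
    g.star h (-α) = -g.star h α :=
  funext fun x => starAt_neg h _ _ _ (α x)

lemma HermitianMetric.star_zero (h : k + l = 4) : g.star h (0 : Form X k F) = 0 :=
  funext fun _ => starAt_zero h _ _ _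

lemma HermitianMetric.star_mapForm (L : F →L[ℝ] G) (h : k + l = 4) (α : Form X k F) :
    g.star h (mapForm L α) = mapForm L (g.star h α) :=
  funext fun x => starAt_compContinuousAlternatingMap h _ _ _ L (α x)

omit [IsManifold (𝓡 4) ∞ X] in
lemma mapForm_add (L : F →L[ℝ] G) (α β : Form X k F) :
    mapForm L (α + β) = mapForm L α + mapForm L β := by
  funext x
  ext v
  exact map_add L _ _

omit [IsManifold (𝓡 4) ∞ X] in
lemma mapForm_neg (L : F →L[ℝ] G) (α : Form X k F) : mapForm L (-α) = -mapForm L α := by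
  funext x
  ext v
  exact map_neg L _

omit [IsManifold (𝓡 4) ∞ X] in
lemma mapForm_zero (L : F →L[ℝ] G) : mapForm L (0 : Form X k F) = 0 := by
  funext x
  ext v
  exact map_zero L

lemma HermitianMetric.codiff_mapForm (L : F →L[ℝ] G) (h : (k + 1) + l = 4) (h' : (l + 1) + k = 4)
    {α : Form X (k + 1) F} (hα : IsSmooth α) :
    g.codiff h h' (mapForm L α) = mapForm L (g.codiff h h' α) := by
  rw [codiff, g.star_mapForm, extD_mapForm L (hα.star g h), g.star_mapForm, codiff, mapForm_neg]

lemma IsSmooth.codiff (h : (k + 1) + l = 4) (h' : (l + 1) + k = 4)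
    {α : Form X (k + 1) F} (hα : IsSmooth α) : IsSmooth (g.codiff h h' α) :=
  ((hα.star g h).extD.star g h').neg

lemma HermitianMetric.laplacian_mapForm (L : F →L[ℝ] G) {α : Form X 2 F} (hα : IsSmooth α) :
    g.laplacian (mapForm L α) = mapForm L (g.laplacian α) := by
  rw [laplacian, extD_mapForm L hα, g.codiff_mapForm L _ _ hα.extD,
    g.codiff_mapForm (k := 1) L _ _ hα, extD_mapForm L (hα.codiff (k := 1) g _ _), laplacian,
    mapForm_add]

lemma HermitianMetric.codiff_of_star_eq (h : (k + 1) + l = 4) (h' : (l + 1) + k = 4)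
    {α : Form X (k + 1) F} {β : Form X l F} (hβ : g.star h α = β) :
    g.codiff h h' α = -g.star h' (extD β) := by
  rw [codiff, hβ]

lemma HermitianMetric.delbarStar_of_star_eq (h : (k + 1) + l = 4) (h' : (l + 1) + k = 4)
    {α : Form X (k + 1) ℂ} {β : Form X l ℂ} (hβ : g.star h α = β) :
    g.delbarStar h h' α = -g.star h' (del J β) := by
  rw [delbarStar, hβ]

/-- On a compact manifold, real anti-self-dual harmonic forms are closed. -/
theorem HermitianMetric.extD_eq_zero_of_antiSelfDual_real [T2Space X] [CompactSpace X]
    {γ : Form X 2 ℝ} (hγ : IsSmooth γ) (hasd : g.IsAntiSelfDual γ) (hlap : g.laplacian γ = 0) :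
    extD γ = 0 := by
  set θ : Form X 1 ℝ := g.star (k := 3) (l := 1) rfl (extD γ) with hθ
  have hθs : IsSmooth θ := hγ.extD.star g _
  have h1 : g.codiff (k := 1) (l := 2) rfl rfl γ = θ := by
    rw [g.codiff_of_star_eq (k := 1) (l := 2) rfl rfl hasd, extD_neg, g.star_neg, neg_neg]
  have h2 : g.star (k := 2) (l := 2) rfl (extD θ) = extD θ := by
    have h3 : g.laplacian γ = extD θ + -g.star (k := 2) (l := 2) rfl (extD θ) := by
      rw [laplacian, h1]
      rfl
    rw [hlap, eq_comm, add_neg_eq_zero] at h3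
    exact h3.symm
  have hw : ∀ x, ∃ c : ℝ, 0 ≤ c ∧ (c = 0 → AlmostHermitian.valueAt (extD γ) x = 0) ∧
      g.wedgeDerivRatio γ θ x = c := by
    intro x
    have hp := g.isHermitianPair x
    have hη := g.valueAt_fundamentalForm x
    obtain ⟨c, hc0, hc, hcw⟩ :=
      exists_wedgeThreeOne_star hp hη stdBasis (AlmostHermitian.valueAt (extD γ) x)
    refine ⟨c, hc0, hc, ?_⟩
    have e1 : wedgeTwoTwo (AlmostHermitian.valueAt γ x) (AlmostHermitian.valueAt (extD θ) x) = 0 := by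
      apply wedgeTwoTwo_eq_zero hp hη stdBasis
      · rw [← g.valueAt_star (k := 2) (l := 2) rfl γ x, hasd]
        rfl
      · rw [← g.valueAt_star (k := 2) (l := 2) rfl (extD θ) x, h2]
    rw [wedgeDerivRatio, wedgeDeriv, e1, add_zero, hθ, g.valueAt_star, hcw,
      AlternatingMap.smul_apply, smul_eq_mul]
    exact mul_div_cancel_right₀ _ (halfSquare_ne_zero hp hη stdBasis)
  have hnn : ∀ x, 0 ≤ g.wedgeDerivRatio γ θ x := fun x => by
    obtain ⟨c, hc0, -, hc⟩ := hw x
    rwa [hc]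
  funext x
  obtain ⟨c, -, hc, hcr⟩ := hw x
  apply hc
  rw [← hcr, g.wedgeDerivRatio_eq_zero_of_nonneg hγ hθs hnn]

/-- On a compact manifold, complex anti-self-dual harmonic forms are closed. -/
theorem HermitianMetric.extD_eq_zero_of_antiSelfDual [T2Space X] [CompactSpace X]
    {γ : Form X 2 ℂ} (hγ : IsSmooth γ) (hasd : g.IsAntiSelfDual γ) (hlap : g.laplacian γ = 0) :
    extD γ = 0 := by
  have h : ∀ L : ℂ →L[ℝ] ℝ, mapForm L (extD γ) = 0 := by
    intro L
    rw [← extD_mapForm L hγ]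
    apply g.extD_eq_zero_of_antiSelfDual_real (hγ.mapForm L)
    · rw [IsAntiSelfDual, g.star_mapForm, hasd, mapForm_neg]
    · rw [g.laplacian_mapForm L hγ, hlap, mapForm_zero]
  funext x
  ext v
  apply Complex.ext
  · exact congrArg (fun α : Form X 3 ℝ => α x v) (h Complex.reCLM)
  · exact congrArg (fun α : Form X 3 ℝ => α x v) (h Complex.imCLM)

lemma part_zero (p q : ℕ) : part J p q (0 : Form X k ℂ) = 0 :=
  funext fun x => bidegreePart_zero (J.toFun x) p q

lemma part_eq_zero_of_hasBidegree {γ : Form X 2 ℂ} (hγ : HasBidegree J 1 1 γ) {p q : ℕ}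
    (hpq : p ≠ 1 ∨ q ≠ 1) : part J p q γ = 0 :=
  funext fun x => bidegreePart_eq_zero_of_one_one (J.sq x) (congrFun hγ x) hpq

lemma extD_part_eq_zero {γ : Form X 2 ℂ} (hγ : HasBidegree J 1 1 γ) (hd : extD γ = 0) (p q : ℕ) :
    extD (part J p q γ) = 0 := by
  by_cases hpq : p = 1 ∧ q = 1
  · rw [hpq.1, hpq.2, show part J 1 1 γ = γ from hγ, hd]
  · rw [part_eq_zero_of_hasBidegree hγ (by tauto), extD_zero]

lemma delbar_eq_zero {γ : Form X 2 ℂ} (hγ : HasBidegree J 1 1 γ) (hd : extD γ = 0) :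
    delbar J γ = 0 :=
  Finset.sum_eq_zero fun pq _ => by rw [extD_part_eq_zero hγ hd, part_zero]

lemma del_eq_zero {γ : Form X 2 ℂ} (hγ : HasBidegree J 1 1 γ) (hd : extD γ = 0) :
    del J γ = 0 :=
  Finset.sum_eq_zero fun pq _ => by rw [extD_part_eq_zero hγ hd, part_zero]

lemma delbar_zero : delbar J (0 : Form X k ℂ) = 0 :=
  Finset.sum_eq_zero fun pq _ => by rw [part_zero, extD_zero, part_zero]

lemma del_zero : del J (0 : Form X k ℂ) = 0 :=
  Finset.sum_eq_zero fun pq _ => by rw [part_zero, extD_zero, part_zero]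

lemma hasBidegree_one_one_iff {γ : Form X 2 ℂ} : HasBidegree J 1 1 γ ↔
    ∀ x (u v : TangentSpace (𝓡 4) x), γ x ![J.toFun x u, J.toFun x v] = γ x ![u, v] := by
  rw [HasBidegree, funext_iff]
  exact forall_congr' fun x => bidegreePart_one_one_eq_self_iff (γ x)

lemma HasBidegree.neg_one_one {γ : Form X 2 ℂ} (hγ : HasBidegree J 1 1 γ) :
    HasBidegree J 1 1 (-γ) := by
  rw [hasBidegree_one_one_iff] at hγ ⊢
  intro x u v
  exact congrArg Neg.neg (hγ x u v)

/-- Closed anti-self-dual forms of bidegree `(1,1)` are `∂̄`-harmonic. -/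
lemma HermitianMetric.mem_delbarHarmonic11 {γ : Form X 2 ℂ} (hs : IsSmooth γ)
    (hb : HasBidegree J 1 1 γ) (hasd : g.IsAntiSelfDual γ) (hd : extD γ = 0) :
    γ ∈ g.delbarHarmonic11 := by
  refine ⟨hs, hb, ?_⟩
  have h1 : g.delbarStar (k := 1) (l := 2) rfl rfl γ = 0 := by
    rw [g.delbarStar_of_star_eq (k := 1) (l := 2) rfl rfl hasd, del_eq_zero hb.neg_one_one (by rw [extD_neg, hd, neg_zero]), g.star_zero, neg_zero]
  have h2 : g.delbarStar (k := 2) (l := 1) rfl rfl (delbar J γ) = 0 := by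
    rw [delbar_eq_zero hb hd, delbarStar, g.star_zero, del_zero, g.star_zero, neg_zero]
  rw [delbarLaplacian, h1, h2, delbar_zero, add_zero]

/-- The complexification of a real anti-self-dual harmonic form is `∂̄`-harmonic. -/
lemma HermitianMetric.mapForm_ofReal_mem [T2Space X] [CompactSpace X] {γ : Form X 2 ℝ}
    (hγ : γ ∈ g.antiSelfDualHarmonicReal) :
    mapForm Complex.ofRealCLM γ ∈ g.delbarHarmonic11 := by
  obtain ⟨hs, hasd, hlap⟩ := hγ
  refine g.mem_delbarHarmonic11 (hs.mapForm _) ?_ ?_ ?_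
  · rw [hasBidegree_one_one_iff]
    intro x u v
    refine congrArg Complex.ofReal (map_J_of_antiSelfDual (g.isHermitianPair x)
      (g.valueAt_fundamentalForm x) stdBasis (AlmostHermitian.valueAt γ x) ?_ u v)
    rw [← g.valueAt_star (k := 2) (l := 2) rfl γ x, hasd]
    rfl
  · rw [IsAntiSelfDual, g.star_mapForm, hasd, mapForm_neg]
  · rw [extD_mapForm _ hs, g.extD_eq_zero_of_antiSelfDual_real hs hasd hlap, mapForm_zero]

omit [IsManifold (𝓡 4) ∞ X] in
/-- Complexification preserves linear independence. -/
lemma linearIndependent_mapForm_ofReal {ι : Type*} {γ : ι → Form X k ℝ}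
    (h : LinearIndependent ℝ γ) :
    LinearIndependent ℂ fun i => mapForm Complex.ofRealCLM (γ i) := by
  rw [linearIndependent_iff'] at h ⊢
  intro s c hc
  have hev : ∀ x v, ∑ i ∈ s, c i * (γ i x v : ℂ) = 0 := by
    intro x v
    let ev : Form X k ℂ →+ ℂ :=
      { toFun := fun α => α x v
        map_zero' := rfl
        map_add' := fun _ _ => rfl }
    have := congrArg ev hc
    rw [map_sum, map_zero] at this
    exact this
  have hreal : ∀ L : ℂ →L[ℝ] ℝ, (∀ (z : ℂ) (r : ℝ), L (z * r) = L z * r) → ∀ i ∈ s, L (c i) = 0 := by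
    intro L hL
    apply h s (fun i => L (c i))
    funext x
    ext v
    let ev : Form X k ℝ →+ ℝ :=
      { toFun := fun α => α x v
        map_zero' := rfl
        map_add' := fun _ _ => rfl }
    have h1 := congrArg L (hev x v)
    rw [map_sum, map_zero] at h1
    simp only [hL] at h1
    change ev (∑ i ∈ s, L (c i) • γ i) = 0
    rw [map_sum]
    exact h1
  intro i hi
  apply Complex.ext
  · exact hreal Complex.reCLM (fun z r => by simp) i hi
  · exact hreal Complex.imCLM (fun z r => by simp) i hi

end Harmonic

end AlmostHermitian

end

theorem mainTheorem6 {X : Type*} [TopologicalSpace X] [T2Space X] [CompactSpace X]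
    [ChartedSpace (EuclideanSpace ℝ (Fin 4)) X] [IsManifold (𝓡 4) ∞ X]
    (J : AlmostHermitian.AlmostComplexStructure X) (g : AlmostHermitian.HermitianMetric J) :
    g.antiSelfDualHarmonic11 ⊆ g.delbarHarmonic11 ∧ g.bMinus ≤ g.h11 := by
  refine ⟨fun γ hγ => ?_, ?_⟩
  · obtain ⟨hs, hb, hasd, hlap⟩ := hγ
    exact g.mem_delbarHarmonic11 hs hb hasd (g.extD_eq_zero_of_antiSelfDual hs hasd hlap)
  · obtain ⟨b, hbA, hspan, hli⟩ := exists_linearIndependent ℝ g.antiSelfDualHarmonicReal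
    rw [AlmostHermitian.HermitianMetric.bMinus, ← hspan, rank_span_set hli,
      AlmostHermitian.HermitianMetric.h11]
    have hmem : ∀ i : b, AlmostHermitian.mapForm Complex.ofRealCLM (i : AlmostHermitian.Form X 2 ℝ) ∈
        Submodule.span ℂ g.delbarHarmonic11 := fun i =>
      Submodule.subset_span (g.mapForm_ofReal_mem (hbA i.2))
    have hc : LinearIndependent ℂ fun i : b =>
        (⟨_, hmem i⟩ : Submodule.span ℂ g.delbarHarmonic11) :=
      LinearIndependent.of_comp (Submodule.span ℂ g.delbarHarmonic11).subtype
        (AlmostHermitian.linearIndependent_mapForm_ofReal hli)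
    exact hc.cardinal_le_rank
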